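/- Let $f:\mathbb R\to\mathbb R$ be a normalised KPP reaction function: $f\in C^1(\mathbb R)$, $f(0)=f(1)=0$, $f'(0)=1$, $f'(1)<0$, $0<f(u)\le u$ for $u\in(0,1)$, and $f(u)<0$ for $u>1$. For $u_c\in(0,1)$ let $f_c(u)=f(u)$ for $u>u_c$ and $f_c(u)=0$ for $u\le u_c$, and write $f_c^+=f_c(u_c^+)=\lim_{u\to u_c^+}f_c(u)$. A permanent form travelling wave with cut-off $u_c$ and speed $v\ge 0$ is a function $U_T\in C^1(\mathbb R)\cap C^2(\mathbb R\setminus\{0\})$ with $$U_T''+vU_T'+f_c(U_T)=0\quad(y\ne 0),\qquad U_T\ge u_c\ (y<0),\qquad 0\le U_T\le u_c\ (y>0),\qquad U_T(0)=u_c,$$ $U_T(y)\to 1$ as $y\to-\infty$ and $U_T(y)\to 0$ as $y\to\infty$. Put $\lambda_+(v)=\tfrac12\left(-v+\sqrt{v^2+4|f'(1)|}\right)$. For each $u_c\in(0,1)$ there is exactly one speed, $v=v^*(u_c)$, for which such a wave exists, and for this speed the wave $U_T$ is unique. Moreover $v^*(u_c)>0$, and 1. $U_T$ is strictly decreasing on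 $\mathbb R$, and $U_T(0)=u_c$; 2. $U_T(y)=u_c\,e^{-v^*(u_c)y}$ for all $y\ge 0$; 3. the one-sided limits $U_T''(0^\pm)$ exist and $U_T''(0^+)-U_T''(0^-)=f_c^+$; 4. $\lambda_+(v^*(u_c))>0$ and $\frac1y\log(1-U_T(y))\to\lambda_+(v^*(u_c))$ as $y\to-\infty$; if moreover $f(u)=f'(1)(u-1)+O\big((1-u)^{1+\delta}\big)$ as $u\to 1^-$ for some $\delta>0$ (for instance, if $f$ is twice differentiable at $1$), then there is a constant $A>0$, depending on $u_c$, with $1-U_T(y)\sim A\,e^{\lambda_+(v^*(u_c))y}$ as $y\to-\infty$. The function $v^*:(0,1)\to(0,\infty)$ is continuous and strictly decreasing, with $v^*(u_c)\to 2$ as $u_c\to 0^+$ and $v^*(u_c)\to 0$ as $u_c\to 1^-$. Here $2$ is the minimum speed without cut-off, that is, the least $v\ge 0$ for which there is a $U\in C^2(\mathbb R)$ with $U''+vU'+f(U)=0$ and $U\ge 0$ on $\mathbb R$, $U(y)\to1$ as $y\to-\infty$ and $U(y)\to0$ as $y\to\infty$. Finally, $v^*(u_c)\sim|f'(1)|^{1/2}(1-u_c)$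 as $u_c\to1^-$. -/

import Mathlib

open Set Filter Topology Asymptotics

/-- Normalised KPP reaction functions. -/
structure IsNormalisedKPP (f : ℝ → ℝ) : Prop where
  contDiff : ContDiff ℝ 1 f
  zero : f 0 = 0
  one : f 1 = 0
  deriv_zero : deriv f 0 = 1
  deriv_one : deriv f 1 < 0
  pos : ∀ u ∈ Ioo (0 : ℝ) 1, 0 < f u
  le_self : ∀ u ∈ Ioo (0 : ℝ) 1, f u ≤ u
  neg : ∀ u ∈ Ioi (1 : ℝ), f u < 0

open Classical in
/-- The reaction function `f` cut off at the threshold `uc`. -/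
noncomputable def cutoff (f : ℝ → ℝ) (uc : ℝ) : ℝ → ℝ :=
  fun u => if uc < u then f u else 0

/-- `U` is a permanent form travelling wave, with propagation speed `v ≥ 0`, of the moving boundary
problem with reaction function `f` cut off at `uc`; `y = 0` is the place of the moving boundary. -/
structure IsCutoffWave (f : ℝ → ℝ) (uc v : ℝ) (U : ℝ → ℝ) : Prop where
  speed_nonneg : 0 ≤ v
  contDiff_one : ContDiff ℝ 1 U
  contDiffOn_two : ContDiffOn ℝ 2 U {0}ᶜ
  ode : ∀ y : ℝ, y ≠ 0 → deriv (deriv U) y + v * deriv U y + cutoff f uc (U y) = 0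
  left : ∀ y : ℝ, y < 0 → uc ≤ U y
  right : ∀ y : ℝ, 0 < y → 0 ≤ U y ∧ U y ≤ uc
  at_zero : U 0 = uc
  tendsto_left : Tendsto U atBot (𝓝 1)
  tendsto_right : Tendsto U atTop (𝓝 0)

/-- `U` is a non-negative permanent form travelling wave, with propagation speed `v ≥ 0`, of the
problem without cut-off. -/
structure IsKPPWave (f : ℝ → ℝ) (v : ℝ) (U : ℝ → ℝ) : Prop where
  speed_nonneg : 0 ≤ v
  contDiff_two : ContDiff ℝ 2 U
  ode : ∀ y : ℝ, deriv (deriv U) y + v * deriv U y + f (U y) = 0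
  nonneg : ∀ y : ℝ, 0 ≤ U y
  tendsto_left : Tendsto U atBot (𝓝 1)
  tendsto_right : Tendsto U atTop (𝓝 0)

/-- The positive eigenvalue `λ₊(v)` of the linearisation of `U'' + v U' + f(U) = 0` at `U = 1`. -/
noncomputable def lambdaPlus (f : ℝ → ℝ) (v : ℝ) : ℝ :=
  (1 / 2) * (-v + Real.sqrt (v ^ 2 + 4 * |deriv f 1|))

/-! For a decreasing wave, view `p = -U'` as a function of `u = U`. Above the cut-off the equation
becomes `p' = v - f(u)/p` with `p(1) = 0`; below it, decay at infinity forces `p = v u`. Since `U`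
is C¹ at `y = 0`, a wave of speed `v` exists exactly when the trajectory `T_v` entering the saddle
at `1` meets the line `p = v u` over `u = uc`.

Everything about `T_v` rests on one comparison principle. As `f ≥ 0` on `[0, 1]`, the field `v -
f/p` is nondecreasing in `p`, so the difference of two solutions cannot decrease in `u` while it is
positive; as trajectories vanish at `1`, it is never positive. This yields uniqueness of `T_v`,
linear barriers near `1`, and `0 ≤ T_v - T_w ≤ (w - v)(1 - u)` for `v ≤ w`. Hence `T_v(u) - v u` is
continuous and strictly decreasing in `v`. It is positive at `v = 0`, and negative at `v = 2`
because `f ≤ u` gives `T_2(u) ≤ u`; its zero is `v*(u)`. Its `u`-derivative is `-f/T_v < 0`, so `v*`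
decreases strictly. Comparison with `T_0`, whose slope at `1` is `-|f'(1)|^{1/2}`, gives the
behaviour as `u → 1`. For `v < 2` the ratio `T_v(u)/u` cannot stay below `v` down to `u = 0`, which
gives the limit `2`.

Conversely, any front leaving `1` stays below `1`, decreases strictly and runs on `T_v`
(`IsLeftFront.deriv_eq`). A wave therefore solves `U' = -P(U)` with a known `P`, and
`exists_profile` gives existence and uniqueness of the profile. The asymptotics at `-∞` follow from
`(log (1 - U))' = p(U)/(1 - U)` and the slope of `T_v` at `1`. -/

/-! ### Comparison principle -/

/-- A function that cannot decrease while it is positive, and is nonpositive at the right end of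
an interval, is nonpositive on the interval. -/
theorem nonpos_of_deriv_nonneg_of_pos {d d' : ℝ → ℝ} {a b : ℝ}
    (hc : ContinuousOn d (Icc a b)) (hd : ∀ x ∈ Ioo a b, HasDerivAt d (d' x) x)
    (h : ∀ x ∈ Ioo a b, 0 < d x → 0 ≤ d' x) (hb : d b ≤ 0) :
    ∀ x ∈ Icc a b, d x ≤ 0 := by
  intro x₀ hx₀
  by_contra! hpos
  have hsub : Icc x₀ b ⊆ Icc a b := Icc_subset_Icc_left hx₀.1
  have hcomp : IsCompact (Icc x₀ b ∩ d ⁻¹' Iic 0) :=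
    isCompact_Icc.of_isClosed_subset
      ((hc.mono hsub).preimage_isClosed_of_isClosed isClosed_Icc isClosed_Iic) inter_subset_left
  -- `c` is the first point after `x₀` with `d ≤ 0`; before it `d` is positive, hence nondecreasing,
  -- so `d c ≥ d x₀ > 0`.
  obtain ⟨c, ⟨hc1, hc2⟩, hc3⟩ := hcomp.exists_isLeast ⟨b, ⟨hx₀.2, le_rfl⟩, hb⟩
  have hlt : ∀ x ∈ Ico x₀ c, 0 < d x := by
    intro x hx
    by_contra! hx'
    exact absurd (hc3 ⟨⟨hx.1, hx.2.le.trans hc1.2⟩, hx'⟩) (not_le.2 hx.2)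
  have hIoo : ∀ x ∈ Ioo x₀ c, x ∈ Ioo a b := fun x hx =>
    ⟨hx₀.1.trans_lt hx.1, hx.2.trans_le hc1.2⟩
  have hmono : MonotoneOn d (Icc x₀ c) := by
    apply monotoneOn_of_deriv_nonneg (convex_Icc _ _)
      (hc.mono ((Icc_subset_Icc_right hc1.2).trans hsub))
    · rw [interior_Icc]
      exact fun x hx => (hd x (hIoo x hx)).differentiableAt.differentiableWithinAt
    · rw [interior_Icc]
      intro x hx
      rw [(hd x (hIoo x hx)).deriv]
      exact h x (hIoo x hx) (hlt x ⟨hx.1.le, hx.2⟩)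
  have := hmono ⟨le_rfl, hc1.1⟩ ⟨hc1.1, le_rfl⟩ hc1.1
  have hc2' : d c ≤ 0 := hc2
  linarith

/-! ### Linear bounds on the reaction function -/

namespace IsNormalisedKPP

variable {f : ℝ → ℝ}

/-- The quotient `f u / (1 - u)`, extended continuously to `u = 1`. -/
theorem exists_factor_one (hf : IsNormalisedKPP f) :
    ∃ F : ℝ → ℝ, Continuous F ∧ (∀ u, f u = F u * (1 - u)) ∧ F 1 = |deriv f 1| ∧
      ∀ u ∈ Ioc (0 : ℝ) 1, 0 < F u := by
  have hd : Differentiable ℝ f := hf.contDiff.differentiable one_ne_zero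
  have hfac : ∀ u, f u = -dslope f 1 u * (1 - u) := by
    intro u
    have := sub_smul_dslope f 1 u
    rw [hf.one, smul_eq_mul] at this
    linarith
  refine ⟨fun u => -dslope f 1 u, ?_, hfac, ?_, ?_⟩
  · have : ContinuousOn (dslope f 1) univ :=
      (continuousOn_dslope univ_mem).2 ⟨hd.continuous.continuousOn, hd 1⟩
    exact (continuousOn_univ.1 this).neg
  · simp [abs_of_neg hf.deriv_one]
  · intro u hu
    rcases eq_or_lt_of_le hu.2 with rfl | h1
    · simpa using hf.deriv_one
    · have := hf.pos u ⟨hu.1, h1⟩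
      rw [hfac u] at this
      exact pos_of_mul_pos_left this (by linarith)

/-- The quotient `f u / u`, extended continuously to `u = 0`. -/
theorem exists_factor_zero (hf : IsNormalisedKPP f) :
    ∃ G : ℝ → ℝ, Continuous G ∧ (∀ u, f u = G u * u) ∧ G 0 = 1 := by
  have hd : Differentiable ℝ f := hf.contDiff.differentiable one_ne_zero
  refine ⟨dslope f 0, ?_, ?_, ?_⟩
  · have : ContinuousOn (dslope f 0) univ :=
      (continuousOn_dslope univ_mem).2 ⟨hd.continuous.continuousOn, hd 0⟩
    exact continuousOn_univ.1 this
  · intro u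
    have := sub_smul_dslope f 0 u
    rw [hf.zero, smul_eq_mul] at this
    linarith
  · simp [hf.deriv_zero]

theorem exists_le_mul_one_sub (hf : IsNormalisedKPP f) :
    ∃ K : ℝ, 0 < K ∧ ∀ u ∈ Icc (0 : ℝ) 1, f u ≤ K * (1 - u) := by
  obtain ⟨F, hF, hfF, -, -⟩ := hf.exists_factor_one
  obtain ⟨K, hK⟩ := (isCompact_Icc (a := (0 : ℝ)) (b := 1)).bddAbove_image hF.continuousOn
  refine ⟨max K 1, by positivity, fun u hu => ?_⟩
  rw [hfF u]
  exact mul_le_mul_of_nonneg_right ((hK ⟨u, hu, rfl⟩).trans (le_max_left _ _)) (by linarith [hu.2])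

theorem exists_mul_one_sub_le (hf : IsNormalisedKPP f) {a : ℝ} (ha : a ∈ Ioo (0 : ℝ) 1) :
    ∃ c : ℝ, 0 < c ∧ ∀ u ∈ Icc a 1, c * (1 - u) ≤ f u := by
  obtain ⟨F, hF, hfF, -, hpos⟩ := hf.exists_factor_one
  obtain ⟨x, hx, hmin⟩ := (isCompact_Icc (a := a) (b := 1)).exists_isMinOn
    ⟨a, le_rfl, ha.2.le⟩ hF.continuousOn
  refine ⟨F x, hpos x ⟨ha.1.trans_le hx.1, hx.2⟩, fun u hu => ?_⟩
  rw [hfF u]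
  exact mul_le_mul_of_nonneg_right (hmin hu) (by linarith [hu.2])

theorem continuous (hf : IsNormalisedKPP f) : Continuous f := hf.contDiff.continuous

theorem nonneg (hf : IsNormalisedKPP f) {u : ℝ} (hu : u ∈ Icc (0 : ℝ) 1) : 0 ≤ f u := by
  rcases eq_or_lt_of_le hu.1 with rfl | h0
  · exact hf.zero.ge
  rcases eq_or_lt_of_le hu.2 with rfl | h1
  · exact hf.one.ge
  · exact (hf.pos u ⟨h0, h1⟩).le

end IsNormalisedKPP

/-! ### Existence of the trajectory into the equilibrium 1 -/

/-- Solutions of the phase-plane equation on an interval bounded away from `1`, between two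
linear barriers. -/
theorem exists_phase_solution_Icc {f : ℝ → ℝ} (hfc : Continuous f) {a b v c K μ M : ℝ}
    (hab : a < b) (hb : b < 1) (hv : 0 ≤ v) (hμ : 0 < μ) (hμc : μ * (v + μ) ≤ c)
    (hM : K ≤ M * M) (hμM : μ ≤ M) (hc : ∀ u ∈ Icc a b, c * (1 - u) ≤ f u)
    (hK : ∀ u ∈ Icc a b, f u ≤ K * (1 - u)) :
    ∃ p : ℝ → ℝ, ContinuousOn p (Icc a b) ∧
      (∀ u ∈ Ioo a b, HasDerivAt p (v - f u / p u) u) ∧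
      (∀ u ∈ Icc a b, μ * (1 - u) ≤ p u ∧ p u ≤ M * (1 - u)) ∧ p b = M * (1 - b) := by
  have hcpos : 0 < c := lt_of_lt_of_le (by positivity) hμc
  have hKpos : 0 < K := by
    have h1 := hc a ⟨le_rfl, hab.le⟩
    have h2 := hK a ⟨le_rfl, hab.le⟩
    have : 0 < c * (1 - a) := mul_pos hcpos (by linarith)
    exact pos_of_mul_pos_left (this.trans_le (h1.trans h2)) (by linarith)
  have hMpos : 0 < M := hμ.trans_le hμM
  have hf0 : ∀ u ∈ Icc a b, 0 ≤ f u := fun u hu =>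
    (mul_nonneg hcpos.le (by linarith [hu.2])).trans (hc u hu)
  have hb' : 0 < 1 - b := by linarith
  set m : ℝ := μ * (1 - b) with hm
  have hmpos : 0 < m := by positivity
  have hmax : ∀ u ∈ Icc a b, ∀ x, μ * (1 - u) ≤ max x (μ * (1 - u)) ∧
      m ≤ max x (μ * (1 - u)) := by
    intro u hu x
    have : m ≤ μ * (1 - u) := by rw [hm]; gcongr; exact hu.2
    exact ⟨le_max_right _ _, this.trans (le_max_right _ _)⟩
  -- Truncating at the lower barrier makes the field bounded and Lipschitz in `x`, so
  -- Picard–Lindelöf applies on all of `[a, b]`, with data at the right end. The barrier estimate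
  -- `hlow` then shows that the truncation is inactive.
  set g : ℝ → ℝ → ℝ := fun u x => v - f u / max x (μ * (1 - u)) with hg
  let Lip : NNReal := ⟨K * (1 - a) / (m * m), div_nonneg (mul_nonneg hKpos.le (by linarith)) (by positivity)⟩
  let L : NNReal := ⟨v + K / μ, by positivity⟩
  let R : NNReal := ⟨(v + K / μ) * (b - a), mul_nonneg (by positivity) (by linarith)⟩
  have hPL : IsPicardLindelof g (tmin := a) (tmax := b) ⟨b, hab.le, le_rfl⟩ (M * (1 - b)) R 0 L Lip := by
    refine ⟨?_, ?_, ?_, ?_⟩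
    · intro u hu
      refine LipschitzWith.lipschitzOnWith (LipschitzWith.of_dist_le_mul fun x y => ?_)
      have hx := (hmax u hu x).2
      have hy := (hmax u hu y).2
      have hx0 := hmpos.trans_le hx
      have hy0 := hmpos.trans_le hy
      have habs := abs_max_sub_max_le_abs x y (μ * (1 - u))
      rw [Real.dist_eq, Real.dist_eq]
      simp only [hg]
      set X := max x (μ * (1 - u))
      set Y := max y (μ * (1 - u))
      have : v - f u / X - (v - f u / Y) = f u * (X - Y) / (X * Y) := by
        field_simp
        ring
      rw [this, abs_div, abs_mul, abs_of_nonneg (hf0 u hu), abs_of_pos (mul_pos hx0 hy0)]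
      change _ ≤ K * (1 - a) / (m * m) * |x - y|
      have hfu : f u ≤ K * (1 - a) := (hK u hu).trans (by gcongr; exact hu.1)
      have hKa : 0 ≤ K * (1 - a) := (hf0 u hu).trans hfu
      rw [div_mul_eq_mul_div]
      gcongr
    · intro x _
      refine ContinuousOn.sub continuousOn_const (hfc.continuousOn.div ?_ ?_)
      · fun_prop
      · intro u hu
        exact (hmpos.trans_le (hmax u hu x).2).ne'
    · intro u hu x _
      have h1 := (hmax u hu x).1
      have hu1 : 0 < 1 - u := by linarith [hu.2]
      have hX : 0 < max x (μ * (1 - u)) := lt_of_lt_of_le (by positivity) h1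
      have h2 : f u / max x (μ * (1 - u)) ≤ K / μ := by
        rw [div_le_div_iff₀ hX hμ]
        calc f u * μ ≤ K * (1 - u) * μ := by gcongr; exact hK u hu
          _ = K * (μ * (1 - u)) := by ring
          _ ≤ _ := by gcongr
      have h3 : 0 ≤ f u / max x (μ * (1 - u)) := div_nonneg (hf0 u hu) hX.le
      change |v - f u / max x (μ * (1 - u))| ≤ v + K / μ
      rw [abs_le]
      constructor <;> linarith
    · change (v + K / μ) * max (b - b) (b - a) ≤ (v + K / μ) * (b - a) - 0
      rw [sub_self, max_eq_right (by linarith), sub_zero]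
  obtain ⟨p, hpb, hp⟩ := hPL.exists_eq_forall_mem_Icc_hasDerivWithinAt
    (x := M * (1 - b)) (by simp)
  have hpb : p b = M * (1 - b) := hpb
  have hcont : ContinuousOn p (Icc a b) := fun u hu => (hp u hu).continuousWithinAt
  have hder : ∀ u ∈ Ioo a b, HasDerivAt p (g u (p u)) u := fun u hu =>
    (hp u (Ioo_subset_Icc_self hu)).hasDerivAt (Icc_mem_nhds hu.1 hu.2)
  have hlow : ∀ u ∈ Icc a b, μ * (1 - u) - p u ≤ 0 := by
    refine nonpos_of_deriv_nonneg_of_pos (d' := fun u => -μ - g u (p u))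
      (by fun_prop) ?_ ?_ ?_
    · intro u hu
      have h1 : HasDerivAt (fun u => μ * (1 - u)) (-μ) u := by
        simpa using ((hasDerivAt_id u).const_sub 1).const_mul μ
      exact h1.sub (hder u hu)
    · intro u hu hpos
      have hu' := Ioo_subset_Icc_self hu
      have hu1 : 0 < 1 - u := by linarith [hu.2]
      simp only [hg]
      rw [max_eq_right (by linarith)]
      have : v + μ ≤ f u / (μ * (1 - u)) := by
        rw [le_div_iff₀ (by positivity)]
        calc (v + μ) * (μ * (1 - u)) = μ * (v + μ) * (1 - u) := by ring
          _ ≤ c * (1 - u) := by gcongr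
          _ ≤ f u := hc u hu'
      linarith
    · rw [hpb]
      have := mul_le_mul_of_nonneg_right hμM hb'.le
      linarith
  have hgp : ∀ u ∈ Icc a b, g u (p u) = v - f u / p u := by
    intro u hu
    simp only [hg]
    rw [max_eq_left (by linarith [hlow u hu])]
  have hupp : ∀ u ∈ Icc a b, p u - M * (1 - u) ≤ 0 := by
    refine nonpos_of_deriv_nonneg_of_pos (d' := fun u => g u (p u) - -M)
      (by fun_prop) ?_ ?_ ?_
    · intro u hu
      have h1 : HasDerivAt (fun u => M * (1 - u)) (-M) u := by
        simpa using ((hasDerivAt_id u).const_sub 1).const_mul M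
      exact (hder u hu).sub h1
    · intro u hu hpos
      have hu' := Ioo_subset_Icc_self hu
      have hu1 : 0 < 1 - u := by linarith [hu.2]
      rw [hgp u hu']
      have hpu : 0 < p u := lt_of_le_of_lt (by positivity) (sub_pos.1 hpos)
      have : f u / p u ≤ M := by
        rw [div_le_iff₀ hpu]
        calc f u ≤ K * (1 - u) := hK u hu'
          _ ≤ M * M * (1 - u) := by gcongr
          _ = M * (M * (1 - u)) := by ring
          _ ≤ M * p u := by gcongr; linarith
      linarith
    · rw [hpb, sub_self]
  refine ⟨p, hcont, fun u hu => ?_, fun u hu => ⟨?_, ?_⟩, hpb⟩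
  · rw [← hgp u (Ioo_subset_Icc_self hu)]
    exact hder u hu
  · linarith [hlow u hu]
  · linarith [hupp u hu]

/-- `p` is the part over `(a, 1]` of the phase-plane trajectory that enters the equilibrium at `1`:
for a decreasing wave profile `U` of speed `v` it is `-U'` as a function of `U`. -/
structure IsTrajectory (f : ℝ → ℝ) (v a : ℝ) (p : ℝ → ℝ) : Prop where
  one : p 1 = 0
  continuousOn : ContinuousOn p (Ioc a 1)
  pos : ∀ u ∈ Ioo a 1, 0 < p u
  hasDerivAt : ∀ u ∈ Ioo a 1, HasDerivAt p (v - f u / p u) u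

theorem IsTrajectory.mono {f p : ℝ → ℝ} {v a a' : ℝ} (h : IsTrajectory f v a p) (ha : a ≤ a') :
    IsTrajectory f v a' p :=
  ⟨h.one, h.continuousOn.mono (Ioc_subset_Ioc_left ha), fun u hu => h.pos u ⟨ha.trans_lt hu.1, hu.2⟩,
    fun u hu => h.hasDerivAt u ⟨ha.trans_lt hu.1, hu.2⟩⟩

theorem div_le_div_left_of_lt {x p q : ℝ} (hx : 0 ≤ x) (hp : 0 < p) (hpq : p < q) :
    x / q ≤ x / p := div_le_div_of_nonneg_left hx hp hpq.le

/-- The field is singular at `u = 1`, so solutions are started on the upper barrier at points `b n ↑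
1`. Comparison makes them decrease with `n` and differ by at most `M (1 - b n)`, so they converge
uniformly. The lower barrier keeps them away from `0` on intervals ending before `1`, so the
derivatives converge uniformly there too. -/
theorem IsNormalisedKPP.exists_isTrajectory_of_pos {f : ℝ → ℝ} (hf : IsNormalisedKPP f) {v a : ℝ}
    (hv : 0 ≤ v) (ha : a ∈ Ioo (0 : ℝ) 1) : ∃ p, IsTrajectory f v a p := by
  obtain ⟨K, hK0, hK⟩ := hf.exists_le_mul_one_sub
  obtain ⟨c, hc0, hc⟩ := hf.exists_mul_one_sub_le ha
  -- The two bounds on `μ` give `μ (v + μ) ≤ c`; `M = 1 + K` gives `K ≤ M²` and `μ ≤ 1 ≤ M`.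
  set μ := min 1 (c / (v + 1)) with hμdef
  set M := 1 + K with hMdef
  have hμ : 0 < μ := by positivity
  have hμ1 : μ ≤ 1 := min_le_left _ _
  have hμc : μ * (v + μ) ≤ c := by
    have h1 : μ ≤ c / (v + 1) := min_le_right _ _
    rw [le_div_iff₀ (by positivity)] at h1
    exact (mul_le_mul_of_nonneg_left (by linarith) hμ.le).trans h1
  have hM0 : 0 < M := by positivity
  have hMM : K ≤ M * M := by nlinarith
  set b : ℕ → ℝ := fun n => 1 - (1 - a) / (n + 2) with hbdef
  have ha1 : 0 < 1 - a := by linarith [ha.2]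
  have hb1 : ∀ n, b n < 1 := fun n => by
    have : 0 < (1 - a) / ((n : ℝ) + 2) := by positivity
    simp only [hbdef]; linarith
  have hab : ∀ n, a < b n := fun n => by
    have : (1 - a) / ((n : ℝ) + 2) < 1 - a := div_lt_self ha1 (by linarith [n.cast_nonneg (α := ℝ)])
    simp only [hbdef]; linarith
  have hbmono : Monotone b := fun m n hmn => by
    simp only [hbdef]; gcongr
  have hblim : Tendsto b atTop (𝓝 1) := by
    have : Tendsto (fun n : ℕ => (1 - a) / ((n : ℝ) + 2)) atTop (𝓝 0) :=
      tendsto_const_nhds.div_atTop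
        (tendsto_atTop_add_const_right _ _ tendsto_natCast_atTop_atTop)
    simpa using this.const_sub 1
  have hex := fun n => exists_phase_solution_Icc hf.continuous (hab n) (hb1 n) hv hμ hμc hMM
    (by linarith) (fun u hu => hc u ⟨hu.1, hu.2.trans (hb1 n).le⟩)
    (fun u hu => hK u ⟨ha.1.le.trans hu.1, hu.2.trans (hb1 n).le⟩)
  choose r hrc hrd hrb hrM using hex
  have hf0 : ∀ u ∈ Icc a 1, 0 ≤ f u := fun u hu => hf.nonneg ⟨ha.1.le.trans hu.1, hu.2⟩
  have hrpos : ∀ n, ∀ u ∈ Icc a (b n), 0 < r n u := fun n u hu =>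
    lt_of_lt_of_le (mul_pos hμ (by linarith [hu.2, hb1 n])) (hrb n u hu).1
  -- Past `b n` the solution is continued along the upper barrier, so that all the approximants live
  -- on `[a, 1]`.
  set q : ℕ → ℝ → ℝ := fun n u => if u ≤ b n then r n u else M * (1 - u) with hqdef
  have hqb : ∀ n, ∀ u ∈ Icc a 1, μ * (1 - u) ≤ q n u ∧ q n u ≤ M * (1 - u) := by
    intro n u hu
    simp only [hqdef]
    split_ifs with h
    · exact hrb n u ⟨hu.1, h⟩
    · exact ⟨mul_le_mul_of_nonneg_right (by linarith) (by linarith [hu.2]), le_rfl⟩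
  have hcmp : ∀ n m, n ≤ m → ∀ u ∈ Icc a 1, q m u ≤ q n u ∧ q n u ≤ q m u + M * (1 - b n) := by
    intro n m hnm u hu
    rcases le_or_gt u (b n) with h | h
    · have hum : u ≤ b m := h.trans (hbmono hnm)
      have hss : Icc a (b n) ⊆ Icc a (b m) := Icc_subset_Icc_right (hbmono hnm)
      simp only [hqdef, if_pos h, if_pos hum]
      have hbn : b n ∈ Icc a (b m) := ⟨(hab n).le, hbmono hnm⟩
      constructor
      · have := nonpos_of_deriv_nonneg_of_pos (d := fun x => r m x - r n x)
          (d' := fun x => (v - f x / r m x) - (v - f x / r n x)) (a := a) (b := b n)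
          (((hrc m).mono hss).sub (hrc n))
          (fun x hx => (hrd m x ⟨hx.1, hx.2.trans_le (hbmono hnm)⟩).sub (hrd n x hx))
          (fun x hx hpos => by
            have := div_le_div_left_of_lt (hf0 x ⟨hx.1.le, (hx.2.trans (hb1 n)).le⟩)
              (hrpos n x (Ioo_subset_Icc_self hx)) (sub_pos.1 hpos)
            linarith)
          (by have := (hrb m (b n) hbn).2; have := hrM n; linarith) u ⟨hu.1, h⟩
        linarith
      · have := nonpos_of_deriv_nonneg_of_pos (d := fun x => r n x - r m x - M * (1 - b n))
          (d' := fun x => (v - f x / r n x) - (v - f x / r m x)) (a := a) (b := b n)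
          (((hrc n).sub ((hrc m).mono hss)).sub continuousOn_const)
          (fun x hx => ((hrd n x hx).sub (hrd m x ⟨hx.1, hx.2.trans_le (hbmono hnm)⟩)).sub_const _)
          (fun x hx hpos => by
            have h0 : 0 < M * (1 - b n) := mul_pos hM0 (by linarith [hb1 n])
            have := div_le_div_left_of_lt (hf0 x ⟨hx.1.le, (hx.2.trans (hb1 n)).le⟩)
              (hrpos m x (hss (Ioo_subset_Icc_self hx))) (show r m x < r n x by linarith)
            linarith)
          (by have := (hrpos m (b n) hbn).le; have := hrM n; linarith) u ⟨hu.1, h⟩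
        linarith
    · have h1 := hqb m u hu
      have h2 : q n u = M * (1 - u) := by simp only [hqdef, if_neg (not_le.2 h)]
      have h3 : 0 ≤ μ * (1 - u) := mul_nonneg hμ.le (by linarith [hu.2])
      have h4 : M * (1 - u) ≤ M * (1 - b n) := by gcongr
      rw [h2]
      exact ⟨h1.2, by linarith⟩
  have hβ : Tendsto (fun n => M * (1 - b n)) atTop (𝓝 0) := by
    simpa using (hblim.const_sub 1).const_mul M
  have hlim : ∀ u, ∃ l, u ∈ Icc a 1 → Tendsto (fun n => q n u) atTop (𝓝 l) := by
    intro u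
    by_cases hu : u ∈ Icc a 1
    · obtain ⟨l, hl⟩ := cauchySeq_tendsto_of_complete
        (cauchySeq_of_le_tendsto_0' (s := fun n => q n u) _ (fun n m hnm => by
          have := hcmp n m hnm u hu
          rw [Real.dist_eq, abs_le]
          constructor <;> linarith [mul_pos hM0 (sub_pos.2 (hb1 n))]) hβ)
      exact ⟨l, fun _ => hl⟩
    · exact ⟨0, fun h => absurd h hu⟩
  choose p hp using hlim
  have hpq : ∀ n, ∀ u ∈ Icc a 1, |q n u - p u| ≤ M * (1 - b n) := by
    intro n u hu
    have h1 := hp u hu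
    have hle : p u ≤ q n u := le_of_tendsto h1
      (eventually_atTop.2 ⟨n, fun m hm => (hcmp n m hm u hu).1⟩)
    have hge : q n u - M * (1 - b n) ≤ p u := ge_of_tendsto h1
      (eventually_atTop.2 ⟨n, fun m hm => by linarith [(hcmp n m hm u hu).2]⟩)
    rw [abs_le]
    constructor <;> linarith
  have hpb : ∀ u ∈ Icc a 1, μ * (1 - u) ≤ p u ∧ p u ≤ M * (1 - u) := fun u hu =>
    ⟨ge_of_tendsto' (hp u hu) fun n => (hqb n u hu).1,
      le_of_tendsto' (hp u hu) fun n => (hqb n u hu).2⟩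
  have hder : ∀ u ∈ Ioo a 1, HasDerivAt p (v - f u / p u) u := by
    intro x hx
    set B := (x + 1) / 2 with hB
    have hxB : x < B := by rw [hB]; linarith [hx.2]
    have hB1 : B < 1 := by rw [hB]; linarith [hx.2]
    have hs : ∀ u ∈ Ioo a B, u ∈ Icc a 1 := fun u hu => ⟨hu.1.le, (hu.2.trans hB1).le⟩
    have hη : 0 < μ * (1 - B) := mul_pos hμ (by linarith)
    have hηle : ∀ u ∈ Ioo a B, μ * (1 - B) ≤ μ * (1 - u) := fun u hu =>
      mul_le_mul_of_nonneg_left (by linarith [hu.2]) hμ.le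
    have hbB : ∀ᶠ n in atTop, B < b n := hblim.eventually (lt_mem_nhds hB1)
    refine hasDerivAt_of_tendstoUniformlyOn (f := q) (l := atTop)
      (f' := fun n u => v - f u / q n u) (g' := fun u => v - f u / p u)
      (isOpen_Ioo (a := a) (b := B)) ?_ ?_ (fun u hu => hp u (hs u hu)) ⟨hx.1, hxB⟩
    · rw [Metric.tendstoUniformlyOn_iff]
      intro ε hε
      have hlim' : Tendsto (fun n => K * (M * (1 - b n)) / ((μ * (1 - B)) * (μ * (1 - B)))) atTop (𝓝 0) := by
        simpa using (hβ.const_mul K).div_const ((μ * (1 - B)) * (μ * (1 - B)))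
      filter_upwards [hlim'.eventually (gt_mem_nhds hε)] with n hn u hu
      refine lt_of_le_of_lt ?_ hn
      have hu1 := hs u hu
      have hp1 := (hηle u hu).trans (hpb u hu1).1
      have hq1 := (hηle u hu).trans (hqb n u hu1).1
      have hp0 := hη.trans_le hp1
      have hq0 := hη.trans_le hq1
      have : v - f u / p u - (v - f u / q n u) = f u * -(q n u - p u) / (p u * q n u) := by
        field_simp
        ring
      rw [Real.dist_eq, this, abs_div, abs_mul, abs_of_nonneg (hf0 u hu1), abs_neg,
        abs_of_pos (mul_pos hp0 hq0)]
      have hfK : f u ≤ K := (hK u ⟨ha.1.le.trans hu1.1, hu1.2⟩).trans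
        (mul_le_of_le_one_right hK0.le (by linarith [hu1.1, ha.1]))
      have hM := hpq n u hu1
      have hM0 : 0 ≤ K * (M * (1 - b n)) := mul_nonneg hK0.le ((abs_nonneg _).trans hM)
      gcongr
    · filter_upwards [hbB] with n hn u hu
      have hun : u < b n := hu.2.trans hn
      have heq : q n =ᶠ[𝓝 u] r n := by
        filter_upwards [gt_mem_nhds hun] with y hy
        simp only [hqdef, if_pos hy.le]
      rw [show q n u = r n u from heq.eq_of_nhds]
      exact (hrd n u ⟨hu.1, hun⟩).congr_of_eventuallyEq heq
  have hone : p 1 = 0 := by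
    have := hpb 1 ⟨ha.2.le, le_rfl⟩
    simp only [sub_self, mul_zero] at this
    exact le_antisymm this.2 this.1
  refine ⟨p, hone, ?_, fun u hu => ?_, hder⟩
  · intro u hu
    rcases eq_or_lt_of_le hu.2 with rfl | h1
    · have hsq : Tendsto (fun u => M * (1 - u)) (𝓝[Ioc a 1] 1) (𝓝 0) := by
        have : ContinuousAt (fun u : ℝ => M * (1 - u)) 1 := by fun_prop
        simpa using this.tendsto.mono_left nhdsWithin_le_nhds
      have hsq' : Tendsto (fun u => μ * (1 - u)) (𝓝[Ioc a 1] 1) (𝓝 0) := by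
        have : ContinuousAt (fun u : ℝ => μ * (1 - u)) 1 := by fun_prop
        simpa using this.tendsto.mono_left nhdsWithin_le_nhds
      rw [ContinuousWithinAt, hone]
      refine tendsto_of_tendsto_of_tendsto_of_le_of_le' hsq' hsq ?_ ?_
      · filter_upwards [self_mem_nhdsWithin] with y hy using (hpb y ⟨hy.1.le, hy.2⟩).1
      · filter_upwards [self_mem_nhdsWithin] with y hy using (hpb y ⟨hy.1.le, hy.2⟩).2
    · exact (hder u ⟨hu.1, h1⟩).continuousAt.continuousWithinAt
  · exact lt_of_lt_of_le (mul_pos hμ (by linarith [hu.2])) (hpb u (Ioo_subset_Icc_self hu)).1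

/-! ### Comparison and uniqueness of trajectories -/

namespace IsTrajectory

variable {f p q : ℝ → ℝ} {v w a : ℝ}

/-- Comparison of a trajectory with an upper barrier. -/
theorem le_of_barrier (h : IsTrajectory f v a p) {ℓ ℓ' : ℝ → ℝ} {u₀ : ℝ} (hu₀ : a < u₀)
    (hℓc : ContinuousOn ℓ (Icc u₀ 1)) (hℓ : ∀ u ∈ Ioo u₀ 1, HasDerivAt ℓ (ℓ' u) u)
    (hsup : ∀ u ∈ Ioo u₀ 1, ℓ u < p u → ℓ' u ≤ v - f u / p u) (h1 : 0 ≤ ℓ 1) :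
    ∀ u ∈ Icc u₀ 1, p u ≤ ℓ u := by
  intro u hu
  have hss : Icc u₀ 1 ⊆ Ioc a 1 := fun x hx => ⟨hu₀.trans_le hx.1, hx.2⟩
  have := nonpos_of_deriv_nonneg_of_pos (d := fun x => p x - ℓ x)
    ((h.continuousOn.mono hss).sub hℓc)
    (fun x hx => (h.hasDerivAt x ⟨hu₀.trans hx.1, hx.2⟩).sub (hℓ x hx))
    (fun x hx hpos => sub_nonneg.2 (hsup x hx (sub_pos.1 hpos)))
    (by rw [h.one]; linarith) u hu
  linarith

/-- Comparison of a trajectory with a lower barrier. -/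
theorem ge_of_barrier (h : IsTrajectory f v a p) {ℓ ℓ' : ℝ → ℝ} {u₀ : ℝ} (hu₀ : a < u₀)
    (hℓc : ContinuousOn ℓ (Icc u₀ 1)) (hℓ : ∀ u ∈ Ioo u₀ 1, HasDerivAt ℓ (ℓ' u) u)
    (hsub : ∀ u ∈ Ioo u₀ 1, p u < ℓ u → v - f u / p u ≤ ℓ' u) (h1 : ℓ 1 ≤ 0) :
    ∀ u ∈ Icc u₀ 1, ℓ u ≤ p u := by
  intro u hu
  have hss : Icc u₀ 1 ⊆ Ioc a 1 := fun x hx => ⟨hu₀.trans_le hx.1, hx.2⟩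
  have := nonpos_of_deriv_nonneg_of_pos (d := fun x => ℓ x - p x)
    (hℓc.sub (h.continuousOn.mono hss))
    (fun x hx => (hℓ x hx).sub (h.hasDerivAt x ⟨hu₀.trans hx.1, hx.2⟩))
    (fun x hx hpos => sub_nonneg.2 (hsub x hx (sub_pos.1 hpos)))
    (by rw [h.one]; linarith) u hu
  linarith

/-- The trajectory of the smaller speed is an upper barrier: where `q > p`, one has `f/q ≤ f/p`,
hence `v - f/p ≤ w - f/q`. -/
theorem anti (hf : IsNormalisedKPP f) (ha : 0 ≤ a) (hp : IsTrajectory f v a p)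
    (hq : IsTrajectory f w a q) (hvw : v ≤ w) {u : ℝ} (hu : u ∈ Ioc a 1) : q u ≤ p u := by
  refine hq.le_of_barrier hu.1 (hp.continuousOn.mono fun x hx => ⟨hu.1.trans_le hx.1, hx.2⟩)
    (fun x hx => hp.hasDerivAt x ⟨hu.1.trans hx.1, hx.2⟩) (fun x hx hlt => ?_) hp.one.ge u
    ⟨le_rfl, hu.2⟩
  have := div_le_div_left_of_lt (hf.nonneg ⟨(ha.trans_lt (hu.1.trans hx.1)).le, hx.2.le⟩)
    (hp.pos x ⟨hu.1.trans hx.1, hx.2⟩) hlt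
  linarith

/-- The term `(w - v)(1 - u)` has slope `-(w - v)`, which exactly offsets the difference of the
speeds. With `anti` this makes the trajectory Lipschitz in the speed, with constant `1 - u`. -/
theorem le_add (hf : IsNormalisedKPP f) (ha : 0 ≤ a) (hp : IsTrajectory f v a p)
    (hq : IsTrajectory f w a q) (hvw : v ≤ w) {u : ℝ} (hu : u ∈ Ioc a 1) :
    p u ≤ q u + (w - v) * (1 - u) := by
  refine hp.le_of_barrier (ℓ := fun x => q x + (w - v) * (1 - x))
    (ℓ' := fun x => w - f x / q x + -(w - v)) hu.1
    ((hq.continuousOn.mono fun x hx => ⟨hu.1.trans_le hx.1, hx.2⟩).add (by fun_prop))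
    (fun x hx => (hq.hasDerivAt x ⟨hu.1.trans hx.1, hx.2⟩).add ?_) (fun x hx hlt => ?_)
    (by simp [hq.one]) u ⟨le_rfl, hu.2⟩
  · simpa using ((hasDerivAt_id x).const_sub 1).const_mul (w - v)
  · have h1 : 0 ≤ (w - v) * (1 - x) := mul_nonneg (by linarith) (by linarith [hx.2])
    have := div_le_div_left_of_lt (hf.nonneg ⟨(ha.trans_lt (hu.1.trans hx.1)).le, hx.2.le⟩)
      (hq.pos x ⟨hu.1.trans hx.1, hx.2⟩) (show q x < p x by linarith)
    linarith

theorem eqOn (hf : IsNormalisedKPP f) (ha : 0 ≤ a) (hp : IsTrajectory f v a p)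
    (hq : IsTrajectory f v a q) : EqOn p q (Ioc a 1) := fun _ hu =>
  le_antisymm (anti hf ha hq hp le_rfl hu) (anti hf ha hp hq le_rfl hu)

end IsTrajectory

/-- A bound `c (1 - u) ≤ f u` with `c > 0` holds only away from `0`, so trajectories were built over
`(a, 1]` for each `a > 0`. Uniqueness glues them; the value at `u` is read off from the one with `a
= u / 2`. -/
theorem IsNormalisedKPP.exists_isTrajectory {f : ℝ → ℝ} (hf : IsNormalisedKPP f) {v : ℝ}
    (hv : 0 ≤ v) : ∃ p, IsTrajectory f v 0 p := by
  have hex : ∀ a, ∃ p, a ∈ Ioo (0 : ℝ) 1 → IsTrajectory f v a p := fun a => by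
    by_cases ha : a ∈ Ioo (0 : ℝ) 1
    · obtain ⟨p, hp⟩ := hf.exists_isTrajectory_of_pos hv ha
      exact ⟨p, fun _ => hp⟩
    · exact ⟨0, fun h => absurd h ha⟩
  choose r hr using hex
  have key : ∀ a ∈ Ioo (0 : ℝ) 1, EqOn (fun u => r (u / 2) u) (r a) (Ioc a 1) := by
    intro a ha u hu
    have hu2 : u / 2 ∈ Ioo (0 : ℝ) 1 := ⟨by linarith [ha.1, hu.1], by linarith [hu.2]⟩
    exact IsTrajectory.eqOn hf (le_max_of_le_left ha.1.le)
      ((hr _ hu2).mono (le_max_right a _)) ((hr a ha).mono (le_max_left _ (u / 2)))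
      ⟨max_lt hu.1 (by linarith [ha.1, hu.1]), hu.2⟩
  have hloc : ∀ u ∈ Ioc (0 : ℝ) 1, u / 2 ∈ Ioo (0 : ℝ) 1 ∧ u ∈ Ioc (u / 2) 1 := fun u hu =>
    ⟨⟨by linarith [hu.1], by linarith [hu.2]⟩, by linarith [hu.1], hu.2⟩
  refine ⟨fun u => r (u / 2) u, ?_, ?_, ?_, ?_⟩
  · exact (hr _ (hloc 1 ⟨one_pos, le_rfl⟩).1).one
  · intro u hu
    obtain ⟨h1, h2⟩ := hloc u hu
    have h3 : ContinuousWithinAt (fun u => r (u / 2) u) (Ioc (u / 2) 1) u :=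
      ((hr _ h1).continuousOn u h2).congr (fun y hy => key _ h1 hy) (key _ h1 h2)
    refine h3.mono_of_mem_nhdsWithin ?_
    filter_upwards [self_mem_nhdsWithin, mem_nhdsWithin_of_mem_nhds (lt_mem_nhds h2.1)] with y hy hy'
    exact ⟨hy', hy.2⟩
  · intro u hu
    obtain ⟨h1, h2⟩ := hloc u ⟨hu.1, hu.2.le⟩
    exact (hr _ h1).pos u ⟨h2.1, hu.2⟩
  · intro u hu
    obtain ⟨h1, h2⟩ := hloc u ⟨hu.1, hu.2.le⟩
    refine ((hr _ h1).hasDerivAt u ⟨h2.1, hu.2⟩).congr_of_eventuallyEq ?_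
    filter_upwards [Ioo_mem_nhds h2.1 hu.2] with y hy
    exact key _ h1 ⟨hy.1, hy.2.le⟩

/-! ### The trajectory near 1 and near 0 -/

theorem lambdaPlus_pos {f : ℝ → ℝ} (hf : deriv f 1 < 0) (v : ℝ) : 0 < lambdaPlus f v := by
  have h : v < Real.sqrt (v ^ 2 + 4 * |deriv f 1|) := by
    refine (le_abs_self v).trans_lt ?_
    rw [← Real.sqrt_sq_eq_abs]
    exact Real.sqrt_lt_sqrt (sq_nonneg v) (by linarith [abs_pos.2 hf.ne])
  unfold lambdaPlus
  linarith

/-- The characteristic equation at `1`. It is the borderline case of the condition on `M` and `m`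
under which the lines in `le_linear` and `ge_linear` are barriers. -/
theorem lambdaPlus_mul (f : ℝ → ℝ) (v : ℝ) :
    lambdaPlus f v * (v + lambdaPlus f v) = |deriv f 1| := by
  have h := Real.sq_sqrt (show 0 ≤ v ^ 2 + 4 * |deriv f 1| by positivity)
  unfold lambdaPlus
  linear_combination h / 4

theorem exists_Ico_of_eventually_nhdsLT_one {P : ℝ → Prop} (h : ∀ᶠ u in 𝓝[<] (1 : ℝ), P u) :
    ∃ u₀ ∈ Ioo (0 : ℝ) 1, ∀ u ∈ Ico u₀ 1, P u := by
  obtain ⟨l, hl, hsub⟩ := (mem_nhdsLT_iff_exists_Ioo_subset' (zero_lt_one (α := ℝ))).1 h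
  have hl1 : l < 1 := hl
  refine ⟨(max l 0 + 1) / 2, ⟨?_, ?_⟩, fun u hu => hsub ⟨?_, hu.2⟩⟩
  · linarith [le_max_right l 0]
  · linarith [max_lt hl1 zero_lt_one]
  · linarith [hu.1, le_max_left l 0, max_lt hl1 zero_lt_one]

namespace IsTrajectory

variable {f p : ℝ → ℝ} {v : ℝ}

/-- The derivative is `-f/p`. Consequently the trajectory crosses the line `p = v u` at most once,
and lies below it to the right of a crossing. -/
theorem strictAntiOn_sub (hf : IsNormalisedKPP f) (h : IsTrajectory f v 0 p) :
    StrictAntiOn (fun u => p u - v * u) (Ioc 0 1) := by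
  refine strictAntiOn_of_deriv_neg (convex_Ioc 0 1) (h.continuousOn.sub (by fun_prop)) ?_
  rw [interior_Ioc]
  intro u hu
  have h1 : HasDerivAt (fun u => p u - v * u) (v - f u / p u - v) u := by
    have h2 : HasDerivAt (fun u => v * u) v u := by simpa using (hasDerivAt_id u).const_mul v
    exact (h.hasDerivAt u hu).sub h2
  rw [h1.deriv]
  have := div_pos (hf.pos u hu) (h.pos u hu)
  linarith

/-- Here the KPP bound `f ≤ u` enters: above the line `p = u` it gives `f/p ≤ 1`, so the slope `2 -
f/p` is at least that of the line. -/
theorem le_self_of_two (hf : IsNormalisedKPP f) (h : IsTrajectory f 2 0 p) {u : ℝ}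
    (hu : u ∈ Ioc (0 : ℝ) 1) : p u ≤ u := by
  refine h.le_of_barrier (ℓ := fun x => x) (ℓ' := fun _ => 1) hu.1 continuousOn_id
    (fun x _ => hasDerivAt_id x) (fun x hx hlt => ?_) zero_le_one u ⟨le_rfl, hu.2⟩
  have hx' : x ∈ Ioo (0 : ℝ) 1 := ⟨hu.1.trans hx.1, hx.2⟩
  have : f x / p x ≤ 1 := (div_le_one (h.pos x hx')).2 ((hf.le_self x hx').trans hlt.le)
  linarith

theorem le_linear (h : IsTrajectory f v 0 p) (hv : 0 ≤ v) {M u₀ : ℝ} (hM : 0 < M) (hu₀ : 0 < u₀)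
    (hfM : ∀ u ∈ Ioo u₀ 1, f u ≤ M * (v + M) * (1 - u)) :
    ∀ u ∈ Icc u₀ 1, p u ≤ M * (1 - u) := by
  refine h.le_of_barrier (ℓ' := fun _ => -M) hu₀ (by fun_prop)
    (fun x _ => by simpa using ((hasDerivAt_id x).const_sub 1).const_mul M)
    (fun x hx hlt => ?_) (by simp)
  have hp := h.pos x ⟨hu₀.trans hx.1, hx.2⟩
  have : f x / p x ≤ v + M := by
    rw [div_le_iff₀ hp]
    have h1 : (v + M) * (M * (1 - x)) ≤ (v + M) * p x :=
      mul_le_mul_of_nonneg_left hlt.le (by linarith)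
    linarith [hfM x hx]
  linarith

theorem ge_linear (hf : IsNormalisedKPP f) (h : IsTrajectory f v 0 p) {m u₀ : ℝ} (hu₀ : 0 < u₀)
    (hfm : ∀ u ∈ Ioo u₀ 1, m * (v + m) * (1 - u) ≤ f u) :
    ∀ u ∈ Icc u₀ 1, m * (1 - u) ≤ p u := by
  refine h.ge_of_barrier (ℓ' := fun _ => -m) hu₀ (by fun_prop)
    (fun x _ => by simpa using ((hasDerivAt_id x).const_sub 1).const_mul m)
    (fun x hx hlt => ?_) (by simp)
  have hx' : x ∈ Ioo (0 : ℝ) 1 := ⟨hu₀.trans hx.1, hx.2⟩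
  have hp := h.pos x hx'
  have : v + m ≤ f x / p x := by
    rw [le_div_iff₀ hp]
    rcases le_or_gt (v + m) 0 with hvm | hvm
    · exact (mul_nonpos_of_nonpos_of_nonneg hvm hp.le).trans (hf.pos x hx').le
    · have h1 : (v + m) * p x ≤ (v + m) * (m * (1 - x)) :=
        mul_le_mul_of_nonneg_left hlt.le hvm.le
      linarith [hfm x hx]
  linarith

/-- The slope of the trajectory at the equilibrium `1` is `-λ₊(v)`. -/
theorem tendsto_div_one_sub (hf : IsNormalisedKPP f) (hv : 0 ≤ v) (h : IsTrajectory f v 0 p) :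
    Tendsto (fun u => p u / (1 - u)) (𝓝[<] 1) (𝓝 (lambdaPlus f v)) := by
  obtain ⟨F, hF, hfF, hF1, -⟩ := hf.exists_factor_one
  have hlam := lambdaPlus_pos hf.deriv_one v
  have hmul := lambdaPlus_mul f v
  set lam := lambdaPlus f v
  have hFt : Tendsto F (𝓝[<] 1) (𝓝 (lam * (v + lam))) := by
    rw [hmul, ← hF1]
    exact (hF.tendsto 1).mono_left nhdsWithin_le_nhds
  rw [tendsto_order]
  constructor
  · intro m₀ hm₀
    set m := (max m₀ 0 + lam) / 2 with hm
    have h1 : max m₀ 0 < lam := max_lt hm₀ hlam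
    have hmlam : m < lam := by rw [hm]; linarith
    have hmm : m₀ < m := by rw [hm]; linarith [le_max_left m₀ 0]
    have hm0 : 0 < m := by rw [hm]; linarith [le_max_right m₀ 0]
    have hlt : m * (v + m) < lam * (v + lam) :=
      mul_lt_mul'' hmlam (by linarith) hm0.le (by linarith)
    obtain ⟨u₀, hu₀, hu₀'⟩ := exists_Ico_of_eventually_nhdsLT_one (hFt.eventually (lt_mem_nhds hlt))
    have := h.ge_linear hf (m := m) hu₀.1 (fun u hu => by
      rw [hfF u]
      exact mul_le_mul_of_nonneg_right (hu₀' u ⟨hu.1.le, hu.2⟩).le (by linarith [hu.2]))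
    filter_upwards [Ioo_mem_nhdsLT hu₀.2] with u hu
    refine hmm.trans_le ((le_div_iff₀ (by linarith [hu.2])).2 (this u ⟨hu.1.le, hu.2.le⟩))
  · intro M₀ hM₀
    set M := (M₀ + lam) / 2 with hM
    have hMlam : lam < M := by rw [hM]; linarith
    have hMM : M < M₀ := by rw [hM]; linarith
    have hlt : lam * (v + lam) < M * (v + M) :=
      mul_lt_mul'' hMlam (by linarith) hlam.le (by linarith)
    obtain ⟨u₀, hu₀, hu₀'⟩ := exists_Ico_of_eventually_nhdsLT_one (hFt.eventually (gt_mem_nhds hlt))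
    have := h.le_linear hv (M := M) (hlam.trans hMlam) hu₀.1 (fun u hu => by
      rw [hfF u]
      exact mul_le_mul_of_nonneg_right (hu₀' u ⟨hu.1.le, hu.2⟩).le (by linarith [hu.2]))
    filter_upwards [Ioo_mem_nhdsLT hu₀.2] with u hu
    exact ((div_le_iff₀ (by linarith [hu.2])).2 (this u ⟨hu.1.le, hu.2.le⟩)).trans_lt hMM

/-- With `C` of either sign, these curves are the refined barriers at `1`: the correction has the
same order as the error in the linearisation of `f`. -/
theorem hasDerivAt_power_barrier (lam C δ : ℝ) {u : ℝ} (hu : u < 1) :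
    HasDerivAt (fun u : ℝ => lam * (1 - u) + C * (1 - u) ^ (1 + δ))
      (-(lam + C * (1 + δ) * (1 - u) ^ δ)) u := by
  have h1 : HasDerivAt (fun u : ℝ => 1 - u) (-1) u := by simpa using (hasDerivAt_id u).const_sub 1
  have h2 := h1.rpow_const (p := 1 + δ) (Or.inl (by linarith))
  refine ((h1.const_mul lam).add (h2.const_mul C)).congr_deriv ?_
  rw [show 1 + δ - 1 = δ by ring]
  ring

/-- Rate of convergence of the slope at the equilibrium `1`. -/
theorem abs_div_one_sub_sub_le (hf : IsNormalisedKPP f) (hv : 0 ≤ v) (h : IsTrajectory f v 0 p)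
    {δ : ℝ} (hδ : 0 < δ)
    (hO : (fun u => f u - deriv f 1 * (u - 1)) =O[𝓝[<] 1] (fun u => (1 - u) ^ (1 + δ))) :
    ∃ C : ℝ, ∃ u₀ ∈ Ioo (0 : ℝ) 1, ∀ u ∈ Ico u₀ 1,
      |p u / (1 - u) - lambdaPlus f v| ≤ C * (1 - u) ^ δ := by
  have hlam := lambdaPlus_pos hf.deriv_one v
  have hmul := lambdaPlus_mul f v
  set lam := lambdaPlus f v
  rw [abs_of_neg hf.deriv_one] at hmul
  obtain ⟨D, hD, hDO⟩ := hO.exists_pos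
  obtain ⟨u₀, hu₀, hb⟩ := exists_Ico_of_eventually_nhdsLT_one hDO.bound
  have hs : ∀ u ∈ Ico u₀ 1, 0 < 1 - u := fun u hu => by linarith [hu.2]
  have hpow : ∀ u ∈ Ico u₀ 1, (1 - u) ^ (1 + δ) = (1 - u) * (1 - u) ^ δ := fun u hu => by
    rw [Real.rpow_add (hs u hu), Real.rpow_one]
  have hfb : ∀ u ∈ Ico u₀ 1, |f u - lam * (v + lam) * (1 - u)| ≤ D * ((1 - u) * (1 - u) ^ δ) := by
    intro u hu
    have := hb u hu
    rw [Real.norm_eq_abs, Real.norm_eq_abs, hpow u hu,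
      abs_of_pos (mul_pos (hs u hu) (Real.rpow_pos_of_pos (hs u hu) δ))] at this
    rw [hmul, show f u - -deriv f 1 * (1 - u) = f u - deriv f 1 * (u - 1) by ring]
    exact this
  -- This makes `D ≤ C (v + lam)`, so the correction of the barrier absorbs the error `D (1 - u)^(1
  -- + δ)` of `f`.
  set C := D / lam with hC
  have hC0 : 0 < C := by positivity
  have hCD : C * lam = D := by rw [hC]; field_simp
  have hCv : D ≤ C * (v + lam) := by nlinarith
  have hcont : ∀ C : ℝ, ContinuousOn (fun u : ℝ => lam * (1 - u) + C * (1 - u) ^ (1 + δ))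
      (Icc u₀ 1) := fun C =>
    ContinuousOn.add (by fun_prop) (ContinuousOn.mul (by fun_prop)
      (ContinuousOn.rpow_const (by fun_prop) fun _ _ => Or.inr (by linarith)))
  have hzero : ((1 : ℝ) - 1) ^ (1 + δ) = 0 := by rw [sub_self, Real.zero_rpow (by linarith)]
  have hupp := h.le_of_barrier hu₀.1 (hcont C)
    (fun u hu => hasDerivAt_power_barrier lam C δ hu.2) (fun u hu hlt => by
      have hu' : u ∈ Ico u₀ 1 := ⟨hu.1.le, hu.2⟩
      have hp := h.pos u ⟨hu₀.1.trans hu.1, hu.2⟩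
      have hT := Real.rpow_pos_of_pos (hs u hu') δ
      have hsu := hs u hu'
      have hfu := (abs_le.1 (hfb u hu')).2
      rw [hpow u hu'] at hlt
      set T := (1 - u) ^ δ
      set s := 1 - u
      have hX : 0 < v + lam + C * (1 + δ) * T := by positivity
      have : f u / p u ≤ v + lam + C * (1 + δ) * T := by
        rw [div_le_iff₀ hp]
        have h1 : (v + lam + C * (1 + δ) * T) * (lam * s + C * (s * T)) ≤
          (v + lam + C * (1 + δ) * T) * p u := mul_le_mul_of_nonneg_left hlt.le hX.le
        have h2 : D * (s * T) ≤ C * (v + lam) * (s * T) :=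
          mul_le_mul_of_nonneg_right hCv (by positivity)
        have h3 : 0 ≤ C * (1 + δ) * T * (lam * s + C * (s * T)) := by positivity
        nlinarith
      linarith) (by rw [hzero]; simp)
  have hlow := h.ge_of_barrier hu₀.1 (hcont (-C))
    (fun u hu => hasDerivAt_power_barrier lam (-C) δ hu.2) (fun u hu hlt => by
      have hu' : u ∈ Ico u₀ 1 := ⟨hu.1.le, hu.2⟩
      have hu'' : u ∈ Ioo (0 : ℝ) 1 := ⟨hu₀.1.trans hu.1, hu.2⟩
      have hp := h.pos u hu''
      have hT := Real.rpow_pos_of_pos (hs u hu') δ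
      have hsu := hs u hu'
      have hfu := (abs_le.1 (hfb u hu')).1
      rw [hpow u hu'] at hlt
      set T := (1 - u) ^ δ
      set s := 1 - u
      have : v + lam - C * (1 + δ) * T ≤ f u / p u := by
        rw [le_div_iff₀ hp]
        rcases le_or_gt (v + lam - C * (1 + δ) * T) 0 with hX | hX
        · exact (mul_nonpos_of_nonpos_of_nonneg hX hp.le).trans (hf.pos u hu'').le
        · have h1 : (v + lam - C * (1 + δ) * T) * p u ≤
            (v + lam - C * (1 + δ) * T) * (lam * s + -C * (s * T)) :=
            mul_le_mul_of_nonneg_left hlt.le hX.le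
          have h2 : D * (s * T) ≤ C * (v + lam) * (s * T) :=
            mul_le_mul_of_nonneg_right hCv (by positivity)
          have h3 : 0 ≤ C * (1 + δ) * T * (lam * s + -C * (s * T)) :=
            mul_nonneg (by positivity) (hp.le.trans hlt.le)
          nlinarith
      linarith) (by rw [hzero]; simp)
  refine ⟨C, u₀, hu₀, fun u hu => ?_⟩
  have h1 := hupp u ⟨hu.1, hu.2.le⟩
  have h2 := hlow u ⟨hu.1, hu.2.le⟩
  have hsu := hs u hu
  simp only [hpow u hu] at h1 h2
  rw [abs_le]
  constructor
  · have : lam - C * (1 - u) ^ δ ≤ p u / (1 - u) := by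
      rw [le_div_iff₀ hsu]; linarith
    linarith
  · have : p u / (1 - u) ≤ lam + C * (1 - u) ^ δ := by
      rw [div_le_iff₀ hsu]; linarith
    linarith

/-- Below the minimum speed `2` the trajectory leaves the sector `p ≤ v u`. -/
theorem exists_mul_lt (hf : IsNormalisedKPP f) (hv : 0 ≤ v) (hv2 : v < 2)
    (h : IsTrajectory f v 0 p) : ∃ u ∈ Ioo (0 : ℝ) 1, v * u < p u := by
  by_contra! hle
  obtain ⟨G, hG, hfG, hG0⟩ := hf.exists_factor_zero
  -- For `z = p/u` the equation reads `u z' = v - z - G/z`. Here `k < 1` and `v + c = 2 k`, so where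
  -- `G > k²` the inequality `z + G/z ≥ 2 k` gives `u z' ≤ -c`. Hence `z + c log u` is nonincreasing
  -- and `z` is unbounded near `0`, against `z ≤ v`.
  set k := (2 + v) / 4 with hk
  set c := (2 - v) / 2 with hc
  have hk1 : k ^ 2 < G 0 := by
    rw [hG0, hk]; nlinarith
  have hc0 : 0 < c := by rw [hc]; linarith
  obtain ⟨ε, hε, hball⟩ := Metric.eventually_nhds_iff.1 (hG.continuousAt.eventually (lt_mem_nhds hk1))
  set u₀ := min (ε / 2) (1 / 2) with hu₀
  have hu₀0 : 0 < u₀ := by positivity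
  have hu₀1 : u₀ < 1 := (min_le_right _ _).trans_lt (by norm_num)
  have hGk : ∀ u ∈ Ioc 0 u₀, k ^ 2 < G u := fun u hu => hball (by
    rw [Real.dist_eq, sub_zero, abs_of_pos hu.1]
    have : u₀ ≤ ε / 2 := min_le_left _ _
    linarith [hu.2])
  have hmem : ∀ u ∈ Ioc 0 u₀, u ∈ Ioo (0 : ℝ) 1 := fun u hu => ⟨hu.1, hu.2.trans_lt hu₀1⟩
  have hder : ∀ u ∈ Ioc 0 u₀, HasDerivAt (fun u => p u / u + c * Real.log u)
      (((v - f u / p u) * u - p u * 1) / u ^ 2 + c * u⁻¹) u := fun u hu =>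
    ((h.hasDerivAt u (hmem u hu)).div (hasDerivAt_id u) hu.1.ne').add
      ((Real.hasDerivAt_log hu.1.ne').const_mul c)
  have hanti : AntitoneOn (fun u => p u / u + c * Real.log u) (Ioc 0 u₀) := by
    refine antitoneOn_of_deriv_nonpos (convex_Ioc 0 u₀)
      (fun u hu => (hder u hu).continuousAt.continuousWithinAt) ?_ ?_
    · exact fun u hu => (hder u (interior_subset hu)).differentiableAt.differentiableWithinAt
    · intro u hu
      replace hu := interior_subset hu
      rw [(hder u hu).deriv]
      have hp := h.pos u (hmem u hu)
      have hu0 := hu.1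
      have hGu := hGk u hu
      rw [hfG u]
      have hkey : (v + c) * (p u * u) ≤ p u ^ 2 + G u * u ^ 2 := by
        have : v + c = 2 * k := by rw [hk, hc]; ring
        rw [this]
        nlinarith [sq_nonneg (p u - k * u), sq_nonneg u]
      have : ((v - G u * u / p u) * u - p u * 1) / u ^ 2 + c * u⁻¹ =
          ((v + c) * (p u * u) - (p u ^ 2 + G u * u ^ 2)) / (p u * u ^ 2) := by
        field_simp
        ring
      rw [this]
      exact div_nonpos_of_nonpos_of_nonneg (by linarith) (by positivity)
  -- Chosen so that `c log u = c log u₀ - v - c`, which forces `p u / u > v`.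
  set u := u₀ * Real.exp (-(v / c + 1)) with hu
  have hexp : Real.exp (-(v / c + 1)) ≤ 1 := Real.exp_le_one_iff.2 (by
    have : 0 ≤ v / c := by positivity
    linarith)
  have hu1 : u ∈ Ioc 0 u₀ := ⟨by positivity, mul_le_of_le_one_right hu₀0.le hexp⟩
  have h1 := hanti hu1 ⟨hu₀0, le_rfl⟩ hu1.2
  have hlog : Real.log u = Real.log u₀ - (v / c + 1) := by
    rw [hu, Real.log_mul hu₀0.ne' (Real.exp_ne_zero _), Real.log_exp]; ring
  have h2 : 0 < p u₀ / u₀ := div_pos (h.pos u₀ ⟨hu₀0, hu₀1⟩) hu₀0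
  have h3 : p u / u ≤ v := (div_le_iff₀ hu1.1).2 (hle u (hmem u hu1))
  simp only [hlog] at h1
  have h4 : c * (v / c) = v := by field_simp
  nlinarith

end IsTrajectory

/-! ### The selected speed -/

/-- A choice of trajectories entering the equilibrium `1`, one for each nonnegative speed. -/
def IsTrajectoryFamily (f : ℝ → ℝ) (T : ℝ → ℝ → ℝ) : Prop := ∀ v, 0 ≤ v → IsTrajectory f v 0 (T v)

theorem IsNormalisedKPP.exists_isTrajectoryFamily {f : ℝ → ℝ} (hf : IsNormalisedKPP f) :
    ∃ T, IsTrajectoryFamily f T := by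
  have : ∀ v, ∃ p, 0 ≤ v → IsTrajectory f v 0 p := fun v => by
    by_cases hv : 0 ≤ v
    · obtain ⟨p, hp⟩ := hf.exists_isTrajectory hv
      exact ⟨p, fun _ => hp⟩
    · exact ⟨0, fun h => absurd h hv⟩
  choose T hT using this
  exact ⟨T, hT⟩

/-- `V` selects, for each cut-off `u`, a positive speed whose trajectory meets the line
`p = V u * u` over `u`. -/
def IsSpeedSelection (T : ℝ → ℝ → ℝ) (V : ℝ → ℝ) : Prop :=
  ∀ u ∈ Ioo (0 : ℝ) 1, 0 < V u ∧ T (V u) u = V u * u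

namespace IsTrajectoryFamily

variable {f V : ℝ → ℝ} {T : ℝ → ℝ → ℝ}

/-- As the speed rises the trajectory falls and the line `v u` rises at rate `u`. This quantitative
monotonicity gives uniqueness of the selected speed and an error bound for it. -/
theorem mul_sub_le (hT : IsTrajectoryFamily f T) (hf : IsNormalisedKPP f) {v w u : ℝ} (hv : 0 ≤ v)
    (hvw : v ≤ w) (hu : u ∈ Ioc (0 : ℝ) 1) :
    u * (w - v) ≤ (T v u - v * u) - (T w u - w * u) := by
  have := IsTrajectory.anti hf le_rfl (hT v hv) (hT w (hv.trans hvw)) hvw hu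
  linarith

theorem lt_of_lt (hT : IsTrajectoryFamily f T) (hf : IsNormalisedKPP f) {v w u : ℝ} (hw : 0 ≤ w)
    (hu : u ∈ Ioc (0 : ℝ) 1) (h : T w u - w * u < T v u - v * u) : v < w := by
  by_contra! hwv
  have h1 := hT.mul_sub_le hf hw hwv hu
  have h2 : 0 ≤ u * (v - w) := mul_nonneg hu.1.le (by linarith)
  linarith

/-- Intermediate value theorem in `v` on `[0, 2]`: `T v u - v u` is positive at `0` and at most `u -
2 u` at `2`. -/
theorem exists_isSpeedSelection (hT : IsTrajectoryFamily f T) (hf : IsNormalisedKPP f) :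
    ∃ V, IsSpeedSelection T V := by
  have : ∀ u, ∃ v, u ∈ Ioo (0 : ℝ) 1 → 0 < v ∧ T v u = v * u := by
    intro u
    by_cases hu : u ∈ Ioo (0 : ℝ) 1
    swap
    · exact ⟨0, fun h => absurd h hu⟩
    have hu' : u ∈ Ioc (0 : ℝ) 1 := Ioo_subset_Ioc_self hu
    have hlip : LipschitzOnWith ⟨1 - u, by linarith [hu.2]⟩ (fun v => T v u) (Icc 0 2) := by
      refine LipschitzOnWith.of_dist_le_mul fun v hv w hw => ?_
      change |T v u - T w u| ≤ (1 - u) * |v - w|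
      rcases le_total v w with h | h
      · have h1 := IsTrajectory.anti hf le_rfl (hT v hv.1) (hT w hw.1) h hu'
        have h2 := IsTrajectory.le_add hf le_rfl (hT v hv.1) (hT w hw.1) h hu'
        rw [abs_of_nonneg (by linarith), abs_of_nonpos (by linarith)]
        linarith
      · have h1 := IsTrajectory.anti hf le_rfl (hT w hw.1) (hT v hv.1) h hu'
        have h2 := IsTrajectory.le_add hf le_rfl (hT w hw.1) (hT v hv.1) h hu'
        rw [abs_of_nonpos (by linarith), abs_of_nonneg (by linarith)]
        linarith
    have hcont : ContinuousOn (fun v => T v u - v * u) (Icc 0 2) :=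
      hlip.continuousOn.sub (by fun_prop)
    have h0 := (hT 0 le_rfl).pos u hu
    have h2 := (hT 2 zero_le_two).le_self_of_two hf hu'
    obtain ⟨v, hv, hv0⟩ := intermediate_value_Icc' zero_le_two hcont
      (show (0 : ℝ) ∈ Icc _ _ from ⟨by linarith [hu.1], by linarith⟩)
    have hv0 : T v u - v * u = 0 := hv0
    refine ⟨v, fun _ => ⟨lt_of_le_of_ne hv.1 ?_, by linarith⟩⟩
    rintro rfl
    linarith
  choose V hV using this
  exact ⟨V, hV⟩

theorem eq_of_isSpeedSelection (hT : IsTrajectoryFamily f T) (hf : IsNormalisedKPP f)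
    (hV : IsSpeedSelection T V) {v u : ℝ} (hu : u ∈ Ioo (0 : ℝ) 1) (hv : 0 ≤ v)
    (h : T v u = v * u) : v = V u := by
  have hu' : u ∈ Ioc (0 : ℝ) 1 := Ioo_subset_Ioc_self hu
  obtain ⟨h0, h1⟩ := hV u hu
  rcases le_total v (V u) with hle | hle
  · have := hT.mul_sub_le hf hv hle hu'
    nlinarith [hu.1]
  · have := hT.mul_sub_le hf h0.le hle hu'
    nlinarith [hu.1]

/-- For fixed `v` this reduces continuity of the selected speed to continuity in `u` of the single
trajectory `T v`. -/
theorem abs_speed_sub_le (hT : IsTrajectoryFamily f T) (hf : IsNormalisedKPP f)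
    (hV : IsSpeedSelection T V) {v u : ℝ} (hu : u ∈ Ioo (0 : ℝ) 1) (hv : 0 ≤ v) :
    |V u - v| ≤ |T v u - v * u| / u := by
  have hu' : u ∈ Ioc (0 : ℝ) 1 := Ioo_subset_Ioc_self hu
  obtain ⟨h0, h1⟩ := hV u hu
  rw [le_div_iff₀ hu.1]
  rcases le_total v (V u) with hle | hle
  · have := hT.mul_sub_le hf hv hle hu'
    rw [abs_of_nonneg (by linarith)]
    refine le_trans ?_ (le_abs_self _)
    linarith
  · have := hT.mul_sub_le hf h0.le hle hu'
    rw [abs_of_nonpos (by linarith)]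
    refine le_trans ?_ (neg_le_abs _)
    linarith

theorem continuousOn_speed (hT : IsTrajectoryFamily f T) (hf : IsNormalisedKPP f)
    (hV : IsSpeedSelection T V) : ContinuousOn V (Ioo 0 1) := by
  intro u₀ hu₀
  refine ContinuousAt.continuousWithinAt ?_
  obtain ⟨h0, h1⟩ := hV u₀ hu₀
  have hc : ContinuousAt (fun u => |T (V u₀) u - V u₀ * u| / u) u₀ :=
    ContinuousAt.div ((((hT _ h0.le).hasDerivAt u₀ hu₀).continuousAt.sub
      (by fun_prop)).abs) continuousAt_id hu₀.1.ne'
  rw [ContinuousAt, tendsto_iff_norm_sub_tendsto_zero]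
  have hlim : Tendsto (fun u => |T (V u₀) u - V u₀ * u| / u) (𝓝 u₀) (𝓝 0) := by
    simpa [h1] using hc.tendsto
  refine squeeze_zero' (Eventually.of_forall fun _ => norm_nonneg _) ?_ hlim
  filter_upwards [Ioo_mem_nhds hu₀.1 hu₀.2] with u hu
  exact hT.abs_speed_sub_le hf hV hu h0.le

/-- With `v = V u₂`, the function `T v u - v u` vanishes at `u₂` and so is positive at `u₁ < u₂`;
hence `v` lies below the zero `V u₁`. -/
theorem strictAntiOn_speed (hT : IsTrajectoryFamily f T) (hf : IsNormalisedKPP f)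
    (hV : IsSpeedSelection T V) : StrictAntiOn V (Ioo 0 1) := by
  intro u₁ h₁ u₂ h₂ h
  obtain ⟨p1, e1⟩ := hV u₁ h₁
  obtain ⟨p2, e2⟩ := hV u₂ h₂
  have := (hT _ p2.le).strictAntiOn_sub hf (Ioo_subset_Ioc_self h₁) (Ioo_subset_Ioc_self h₂) h
  simp only at this
  exact hT.lt_of_lt hf p1.le (Ioo_subset_Ioc_self h₁) (by linarith)

theorem speed_lt_two (hT : IsTrajectoryFamily f T) (hf : IsNormalisedKPP f)
    (hV : IsSpeedSelection T V) {u : ℝ} (hu : u ∈ Ioo (0 : ℝ) 1) : V u < 2 := by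
  obtain ⟨h0, h1⟩ := hV u hu
  have := (hT 2 zero_le_two).le_self_of_two hf (Ioo_subset_Ioc_self hu)
  exact hT.lt_of_lt hf zero_le_two (Ioo_subset_Ioc_self hu) (by linarith [hu.1])

theorem tendsto_speed_zero (hT : IsTrajectoryFamily f T) (hf : IsNormalisedKPP f)
    (hV : IsSpeedSelection T V) : Tendsto V (𝓝[>] 0) (𝓝 2) := by
  rw [tendsto_order]
  constructor
  · intro v hv
    -- Trajectories are available for nonnegative speeds only.
    have hv0 : 0 ≤ max v 0 := le_max_right _ _
    obtain ⟨u₁, hu₁, hlt⟩ := (hT _ hv0).exists_mul_lt hf hv0 (max_lt hv zero_lt_two)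
    filter_upwards [Ioo_mem_nhdsGT hu₁.1] with u hu
    have hu' : u ∈ Ioo (0 : ℝ) 1 := ⟨hu.1, hu.2.trans hu₁.2⟩
    obtain ⟨h0, h1⟩ := hV u hu'
    have := (hT _ hv0).strictAntiOn_sub hf (Ioo_subset_Ioc_self hu') (Ioo_subset_Ioc_self hu₁) hu.2
    simp only at this
    exact (le_max_left v 0).trans_lt
      (hT.lt_of_lt hf h0.le (Ioo_subset_Ioc_self hu') (by linarith))
  · intro v hv
    filter_upwards [Ioo_mem_nhdsGT one_pos] with u hu
    exact (hT.speed_lt_two hf hV hu).trans hv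

theorem tendsto_speed_one (hT : IsTrajectoryFamily f T) (hf : IsNormalisedKPP f)
    (hV : IsSpeedSelection T V) : Tendsto V (𝓝[<] 1) (𝓝 0) := by
  have hc : Tendsto (fun u => T 0 u / u) (𝓝[<] 1) (𝓝 0) := by
    have h1 : Tendsto (T 0) (𝓝[<] 1) (𝓝 0) := by
      have := (hT 0 le_rfl).continuousOn 1 ⟨one_pos, le_rfl⟩
      rw [ContinuousWithinAt, (hT 0 le_rfl).one] at this
      refine this.mono_left ?_
      rw [← nhdsWithin_Ioo_eq_nhdsLT (zero_lt_one (α := ℝ))]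
      exact nhdsWithin_mono _ Ioo_subset_Ioc_self
    have h2 : Tendsto (fun u : ℝ => u) (𝓝[<] 1) (𝓝 1) := tendsto_id.mono_left nhdsWithin_le_nhds
    have h3 := h1.div h2 one_ne_zero
    rwa [zero_div] at h3
  refine tendsto_of_tendsto_of_tendsto_of_le_of_le' tendsto_const_nhds hc ?_ ?_
  · filter_upwards [Ioo_mem_nhdsLT one_pos] with u hu using (hV u hu).1.le
  · filter_upwards [Ioo_mem_nhdsLT one_pos] with u hu
    obtain ⟨h0, h1⟩ := hV u hu
    have := IsTrajectory.anti hf le_rfl (hT 0 le_rfl) (hT _ h0.le) h0.le (Ioo_subset_Ioc_self hu)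
    rw [le_div_iff₀ hu.1]
    linarith

/-- Comparison with speed `0` gives `T 0 u - V u (1 - u) ≤ V u * u ≤ T 0 u`. After division by `u (1
- u)` both bounds tend to `λ₊(0) = |f'(1)|^{1/2}`. -/
theorem speed_isEquivalent (hT : IsTrajectoryFamily f T) (hf : IsNormalisedKPP f)
    (hV : IsSpeedSelection T V) :
    V ~[𝓝[<] 1] (fun u => |deriv f 1| ^ (1 / 2 : ℝ) * (1 - u)) := by
  have hlam : lambdaPlus f 0 = |deriv f 1| ^ (1 / 2 : ℝ) := by
    rw [← Real.sqrt_eq_rpow]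
    unfold lambdaPlus
    rw [show (0 : ℝ) ^ 2 + 4 * |deriv f 1| = 2 ^ 2 * |deriv f 1| by ring,
      Real.sqrt_mul (by norm_num), Real.sqrt_sq zero_le_two]
    ring
  have hpos := lambdaPlus_pos hf.deriv_one 0
  rw [← hlam]
  have hid : Tendsto (fun u : ℝ => u) (𝓝[<] 1) (𝓝 1) := tendsto_id.mono_left nhdsWithin_le_nhds
  have hr := (hT 0 le_rfl).tendsto_div_one_sub hf le_rfl
  have hlow : Tendsto (fun u => (T 0 u / (1 - u) - V u) / u) (𝓝[<] 1) (𝓝 (lambdaPlus f 0)) := by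
    have h3 := (hr.sub (hT.tendsto_speed_one hf hV)).div hid one_ne_zero
    rwa [sub_zero, div_one] at h3
  have hupp : Tendsto (fun u => (T 0 u / (1 - u)) / u) (𝓝[<] 1) (𝓝 (lambdaPlus f 0)) := by
    have h3 := hr.div hid one_ne_zero
    rwa [div_one] at h3
  have hV1 : Tendsto (fun u => V u / (1 - u)) (𝓝[<] 1) (𝓝 (lambdaPlus f 0)) := by
    refine tendsto_of_tendsto_of_tendsto_of_le_of_le' hlow hupp ?_ ?_
    · filter_upwards [Ioo_mem_nhdsLT one_pos] with u hu
      obtain ⟨h0, h1⟩ := hV u hu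
      have hu1 : 0 < 1 - u := by linarith [hu.2]
      have := IsTrajectory.le_add hf le_rfl (hT 0 le_rfl) (hT _ h0.le) h0.le
        (Ioo_subset_Ioc_self hu)
      rw [div_le_iff₀ hu.1, sub_le_iff_le_add, div_le_iff₀ hu1]
      have e : (V u / (1 - u) * u + V u) * (1 - u) = V u * u + V u * (1 - u) := by
        field_simp
      rw [e]
      linarith
    · filter_upwards [Ioo_mem_nhdsLT one_pos] with u hu
      obtain ⟨h0, h1⟩ := hV u hu
      have hu1 : 0 < 1 - u := by linarith [hu.2]
      have := IsTrajectory.anti hf le_rfl (hT 0 le_rfl) (hT _ h0.le) h0.le (Ioo_subset_Ioc_self hu)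
      rw [le_div_iff₀ hu.1, div_mul_eq_mul_div]
      gcongr
      linarith
  refine isEquivalent_of_tendsto_one ?_
  have := hV1.div_const (lambdaPlus f 0)
  rw [div_self hpos.ne'] at this
  refine this.congr fun u => ?_
  rw [Pi.div_apply, div_div, mul_comm]

end IsTrajectoryFamily

/-! ### Profiles from the first-order equation -/

theorem sigmoid_log_div {w : ℝ} (hw : w ∈ Ioo (0 : ℝ) 1) :
    Real.sigmoid (Real.log (w / (1 - w))) = w := by
  have h1 : 0 < 1 - w := by linarith [hw.2]
  have h0 := hw.1
  rw [Real.sigmoid_def, Real.exp_neg, Real.exp_log (by positivity)]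
  field_simp
  ring

theorem hasDerivAt_log_div_comp {W : ℝ → ℝ} {W' y : ℝ} (hW : HasDerivAt W W' y)
    (hy : W y ∈ Ioo (0 : ℝ) 1) :
    HasDerivAt (fun y => Real.log (W y / (1 - W y))) (W' / (W y * (1 - W y))) y := by
  have h1 : 0 < 1 - W y := by linarith [hy.2]
  have h0 := hy.1
  have := (hW.div (hW.const_sub 1) h1.ne').log (by simp only [Pi.div_apply]; positivity)
  refine this.congr_deriv ?_
  simp only [Pi.div_apply]
  field_simp
  ring

/-- The autonomous equation `U' = -P U` on `(0, 1)`, with `P` continuous and positive and with at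
most linear decay at both ends, has exactly one global solution through each point, and it
connects `1` to `0`. -/
theorem exists_profile {P : ℝ → ℝ} {M u₀ : ℝ} (hPc : ContinuousOn P (Ioo 0 1))
    (hP : ∀ u ∈ Ioo (0 : ℝ) 1, 0 < P u) (hP0 : ∀ u ∈ Ioo (0 : ℝ) 1, P u ≤ M * u)
    (hP1 : ∀ u ∈ Ioo (0 : ℝ) 1, P u ≤ M * (1 - u)) (hu₀ : u₀ ∈ Ioo (0 : ℝ) 1) :
    ∃ U : ℝ → ℝ, U 0 = u₀ ∧ (∀ y, U y ∈ Ioo (0 : ℝ) 1) ∧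
      (∀ y, HasDerivAt U (-P (U y)) y) ∧ Tendsto U atBot (𝓝 1) ∧ Tendsto U atTop (𝓝 0) ∧
      ∀ W : ℝ → ℝ, W 0 = u₀ → (∀ y, W y ∈ Ioo (0 : ℝ) 1) →
        (∀ y, HasDerivAt W (-P (W y)) y) → W = U := by
  have hσ : ∀ t, Real.sigmoid t ∈ Ioo (0 : ℝ) 1 := fun t =>
    ⟨Real.sigmoid_pos t, Real.sigmoid_lt_one t⟩
  -- In the logistic coordinate `u = σ(t)` the equation is `dt/dy = -1/Q(t)`, so `-y` is a primitive
  -- of `Q`. The linear bounds on `P` keep `Q` above `1/(2M)`; the primitive is thus a bijection of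
  -- the line, and its inverse gives a global solution.
  set Q : ℝ → ℝ := fun t => Real.sigmoid t * (1 - Real.sigmoid t) / P (Real.sigmoid t) with hQ
  have hQc : Continuous Q := by
    refine Continuous.div (by fun_prop) ?_ fun t => (hP _ (hσ t)).ne'
    exact hPc.comp_continuous continuous_sigmoid hσ
  have hM : 0 < M := pos_of_mul_pos_left ((hP u₀ hu₀).trans_le (hP0 u₀ hu₀)) hu₀.1.le
  have hQpos : ∀ t, 0 < Q t := fun t =>
    div_pos (mul_pos (hσ t).1 (by linarith [(hσ t).2])) (hP _ (hσ t))
  have hQlow : ∀ t, 1 / (2 * M) ≤ Q t := fun t => by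
    have h1 := hσ t
    simp only [hQ]
    rw [div_le_div_iff₀ (by positivity) (hP _ h1), one_mul]
    rcases le_total (Real.sigmoid t) (1 / 2) with h | h
    · refine (hP0 _ h1).trans ?_
      have : 0 ≤ M * Real.sigmoid t := mul_nonneg hM.le h1.1.le
      nlinarith
    · refine (hP1 _ h1).trans ?_
      have : 0 ≤ M * (1 - Real.sigmoid t) := mul_nonneg hM.le (by linarith [h1.2])
      nlinarith
  set t₀ := Real.log (u₀ / (1 - u₀)) with ht₀
  set Y : ℝ → ℝ := fun t => ∫ s in t₀..t, Q s with hY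
  have hYd : ∀ t, HasDerivAt Y (Q t) t := fun t =>
    intervalIntegral.integral_hasDerivAt_right (hQc.intervalIntegrable _ _)
      hQc.aestronglyMeasurable.stronglyMeasurableAtFilter hQc.continuousAt
  have hY0 : Y t₀ = 0 := intervalIntegral.integral_same
  have hYmono : StrictMono Y := strictMono_of_deriv_pos fun t => by
    rw [(hYd t).deriv]; exact hQpos t
  have hYlin : Monotone fun t => Y t - 1 / (2 * M) * t := by
    have hd : ∀ t, HasDerivAt (fun t => Y t - 1 / (2 * M) * t) (Q t - 1 / (2 * M)) t := fun t => by
      have h2 : HasDerivAt (fun t => 1 / (2 * M) * t) (1 / (2 * M)) t := by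
        simpa using (hasDerivAt_id t).const_mul (1 / (2 * M))
      exact (hYd t).sub h2
    refine monotone_of_deriv_nonneg (fun t => (hd t).differentiableAt) fun t => ?_
    rw [(hd t).deriv]
    linarith [hQlow t]
  have hc : 0 < 1 / (2 * M) := by positivity
  have hYtop : Tendsto Y atTop atTop := by
    have h1 : Tendsto (fun t => (Y t₀ - 1 / (2 * M) * t₀) + 1 / (2 * M) * t) atTop atTop :=
      tendsto_atTop_add_const_left _ _ (tendsto_id.const_mul_atTop hc)
    refine tendsto_atTop_mono' _ ?_ h1
    filter_upwards [eventually_ge_atTop t₀] with t ht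
    have := hYlin ht
    simp only at this
    linarith
  have hYbot : Tendsto Y atBot atBot := by
    have h1 : Tendsto (fun t => (Y t₀ - 1 / (2 * M) * t₀) + 1 / (2 * M) * t) atBot atBot :=
      tendsto_atBot_add_const_left _ _ (tendsto_id.const_mul_atBot hc)
    refine tendsto_atBot_mono' _ ?_ h1
    filter_upwards [eventually_le_atBot t₀] with t ht
    have := hYlin ht
    simp only at this
    linarith
  have hYc : Continuous Y := continuous_iff_continuousAt.2 fun t => (hYd t).continuousAt
  have hYsurj : Function.Surjective Y := hYc.surjective hYtop hYbot
  set e : ℝ ≃o ℝ := StrictMono.orderIsoOfSurjective Y hYmono hYsurj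
  have he : ∀ t, e t = Y t := fun _ => rfl
  have hed : ∀ y, HasDerivAt e.symm (Q (e.symm y))⁻¹ y := fun y =>
    HasDerivAt.of_local_left_inverse e.symm.continuous.continuousAt (hYd _) (hQpos _).ne'
      (Eventually.of_forall fun z => e.apply_symm_apply z)
  refine ⟨fun y => Real.sigmoid (e.symm (-y)), ?_, fun y => hσ _, fun y => ?_, ?_, ?_, ?_⟩
  · have : e.symm (-0) = t₀ := by rw [neg_zero, ← hY0, ← he, e.symm_apply_apply]
    simp only [this]
    exact sigmoid_log_div hu₀
  · have h1 : HasDerivAt (fun y => e.symm (-y)) ((Q (e.symm (-y)))⁻¹ * -1) y :=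
      (hed (-y)).comp y (hasDerivAt_neg y)
    refine ((Real.hasDerivAt_sigmoid (e.symm (-y))).comp y h1).congr_deriv ?_
    have h2 := hσ (e.symm (-y))
    have h3 : 0 < 1 - Real.sigmoid (e.symm (-y)) := by linarith [h2.2]
    have h4 := hP _ h2
    have h5 := h2.1
    simp only [hQ]
    field_simp
  · exact Real.tendsto_sigmoid_atTop.comp (e.symm.tendsto_atTop.comp tendsto_neg_atBot_atTop)
  · exact Real.tendsto_sigmoid_atBot.comp (e.symm.tendsto_atBot.comp tendsto_neg_atTop_atBot)
  · intro W hW0 hW hWd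
    set t : ℝ → ℝ := fun y => Real.log (W y / (1 - W y)) with ht
    have hσt : ∀ y, Real.sigmoid (t y) = W y := fun y => sigmoid_log_div (hW y)
    -- Separation of variables: along any solution `Y(t) + y` is constant, which determines `t`.
    have hd : ∀ y, HasDerivAt (fun y => Y (t y) + y) 0 y := fun y => by
      have h1 := ((hYd (t y)).comp y (hasDerivAt_log_div_comp (hWd y) (hW y))).add (hasDerivAt_id y)
      refine h1.congr_deriv ?_
      have h2 := hW y
      have h3 : 0 < 1 - W y := by linarith [h2.2]
      have h4 := hP _ h2
      have h5 := h2.1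
      simp only [hQ, hσt]
      field_simp
      ring
    funext y
    have h1 := is_const_of_deriv_eq_zero (fun y => (hd y).differentiableAt)
      (fun y => (hd y).deriv) y 0
    have h2 : t 0 = t₀ := by simp only [ht, hW0, ht₀]
    rw [h2, hY0] at h1
    have h3 : t y = e.symm (-y) := by
      rw [OrderIso.eq_symm_apply, he]
      linarith
    rw [← h3, hσt]

/-! ### Fronts leaving 1 at minus infinity -/

theorem le_of_mem_interior_Iic {y b : ℝ} (h : y ∈ interior (Iic b)) : y ≤ b :=
  mem_Iic.1 (interior_subset h)

/-- `W`, with derivative `W₁`, solves `W'' + v W' + f(W) = 0` on `(-∞, b]`, is nonnegative, tends to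
`1` at `-∞` and is less than `1` at `b`. -/
structure IsLeftFront (f : ℝ → ℝ) (v b : ℝ) (W W₁ : ℝ → ℝ) : Prop where
  hasDerivAt : ∀ y ≤ b, HasDerivAt W (W₁ y) y
  hasDerivAt_deriv : ∀ y ≤ b, HasDerivAt W₁ (-v * W₁ y - f (W y)) y
  nonneg : ∀ y ≤ b, 0 ≤ W y
  end_lt_one : W b < 1
  tendsto : Tendsto W atBot (𝓝 1)

namespace IsLeftFront

variable {f W W₁ : ℝ → ℝ} {v b : ℝ}

/-- At an interior maximum above `1`, where `f < 0`, the equation would force `W'' > 0`. -/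
theorem le_one (h : IsLeftFront f v b W W₁) (hf : IsNormalisedKPP f) {y : ℝ} (hy : y ≤ b) :
    W y ≤ 1 := by
  by_contra! hlt
  obtain ⟨a, ha, hay⟩ := ((h.tendsto.eventually (gt_mem_nhds hlt)).and
    (eventually_le_atBot y)).exists
  have hcont : ContinuousOn W (Icc a b) := fun x hx =>
    (h.hasDerivAt x hx.2).continuousAt.continuousWithinAt
  obtain ⟨c, hc, hmax⟩ := isCompact_Icc.exists_isMaxOn ⟨y, hay, hy⟩ hcont
  have hyc : W y ≤ W c := hmax ⟨hay, hy⟩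
  have hac : a < c := lt_of_le_of_ne hc.1 (by rintro rfl; linarith)
  have hcb : c < b := lt_of_le_of_ne hc.2 (by rintro rfl; linarith [h.end_lt_one])
  have hlmax : IsLocalMax W c := hmax.isLocalMax (Icc_mem_nhds hac hcb)
  have hW₁ : W₁ c = 0 := hlmax.hasDerivAt_eq_zero (h.hasDerivAt c hc.2)
  have heq : deriv W =ᶠ[𝓝 c] W₁ := by
    filter_upwards [gt_mem_nhds hcb] with x hx using (h.hasDerivAt x hx.le).deriv
  have hdd : deriv (deriv W) c = - f (W c) := by
    rw [heq.deriv_eq, (h.hasDerivAt_deriv c hc.2).deriv, hW₁]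
    ring
  have hneg := hf.neg (W c) (hlt.trans_le hyc)
  -- The maximum would also be a local minimum, so `W` would be locally constant with `W'' = 0`.
  have hlmin : IsLocalMin W c := isLocalMin_of_deriv_deriv_pos (by rw [hdd]; linarith)
    (by rw [heq.eq_of_nhds, hW₁]) (h.hasDerivAt c hc.2).continuousAt
  have hconst : W =ᶠ[𝓝 c] fun _ => W c := by
    filter_upwards [hlmax, hlmin] with x h1 h2 using le_antisymm h1 h2
  have h2 : deriv (deriv W) c = 0 := by
    rw [hconst.deriv.deriv_eq]
    simp
  linarith

/-- The derivative is `-exp (v y) f(W) ≤ 0`; a nonnegative or positive sign of `W'` therefore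
propagates to the left. -/
theorem antitoneOn_exp_mul (h : IsLeftFront f v b W W₁) (hf : IsNormalisedKPP f) :
    AntitoneOn (fun y => Real.exp (v * y) * W₁ y) (Iic b) := by
  have hd : ∀ y ≤ b, HasDerivAt (fun y => Real.exp (v * y) * W₁ y)
      (-(Real.exp (v * y) * f (W y))) y := fun y hy => by
    have h2 : HasDerivAt (fun y => v * y) v y := by simpa using (hasDerivAt_id y).const_mul v
    refine (h2.exp.mul (h.hasDerivAt_deriv y hy)).congr_deriv ?_
    ring
  refine antitoneOn_of_deriv_nonpos (convex_Iic b)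
    (fun y hy => (hd y hy).continuousAt.continuousWithinAt)
    (fun y hy => (hd y (le_of_mem_interior_Iic hy)).differentiableAt.differentiableWithinAt)
    fun y hy => ?_
  replace hy := le_of_mem_interior_Iic hy
  rw [(hd y hy).deriv]
  have := mul_nonneg (Real.exp_pos (v * y)).le (hf.nonneg ⟨h.nonneg y hy, h.le_one hf hy⟩)
  linarith

theorem deriv_nonpos (h : IsLeftFront f v b W W₁) (hf : IsNormalisedKPP f) {y : ℝ} (hy : y ≤ b) :
    W₁ y ≤ 0 := by
  by_contra! hpos
  have hpos' : ∀ x ≤ y, 0 < W₁ x := fun x hx => by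
    have := h.antitoneOn_exp_mul hf (hx.trans hy) hy hx
    simp only at this
    exact pos_of_mul_pos_right ((mul_pos (Real.exp_pos _) hpos).trans_le this) (Real.exp_pos _).le
  have hmono : StrictMonoOn W (Iic y) := by
    refine strictMonoOn_of_deriv_pos (convex_Iic y)
      (fun x hx => (h.hasDerivAt x (le_trans hx hy)).continuousAt.continuousWithinAt) fun x hx => ?_
    replace hx := le_of_mem_interior_Iic hx
    rw [(h.hasDerivAt x (le_trans hx hy)).deriv]
    exact hpos' x hx
  have h1 : W (y - 1) < W y := hmono (by simp) (by simp) (by linarith)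
  have h2 : 1 ≤ W (y - 1) := le_of_tendsto h.tendsto (by
    filter_upwards [eventually_le_atBot (y - 1)] with x hx
    exact hmono.monotoneOn (by simp only [mem_Iic]; linarith) (by simp) hx)
  linarith [h.le_one hf hy]

/-- Touching `1` forces `W' = 0`, so `W` would agree with the equilibrium up to `b`. Grönwall for
`W'² + (1 - W)²` proves this, and the value at `b` excludes it. -/
theorem lt_one (h : IsLeftFront f v b W W₁) (hf : IsNormalisedKPP f) {y : ℝ} (hy : y ≤ b) :
    W y < 1 := by
  refine lt_of_le_of_ne (h.le_one hf hy) fun heq => ?_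
  have hyb : y < b := lt_of_le_of_ne hy (by rintro rfl; exact h.end_lt_one.ne heq)
  have hlmax : IsLocalMax W y := by
    filter_upwards [gt_mem_nhds hyb] with x hx
    rw [heq]
    exact h.le_one hf hx.le
  have hW₁ : W₁ y = 0 := hlmax.hasDerivAt_eq_zero (h.hasDerivAt y hy)
  obtain ⟨K, hK0, hK⟩ := hf.exists_le_mul_one_sub
  have hE : ∀ x ≤ b, HasDerivAt (fun x => W₁ x ^ 2 + (1 - W x) ^ 2)
      (2 * W₁ x * (-v * W₁ x - f (W x)) - 2 * (1 - W x) * W₁ x) x := fun x hx => by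
    refine (((h.hasDerivAt_deriv x hx).pow 2).add
      (((h.hasDerivAt x hx).const_sub 1).pow 2)).congr_deriv ?_
    norm_num
    ring
  have hz := eq_zero_of_abs_deriv_le_mul_abs_self_of_eq_zero_right
    (f := fun x => W₁ x ^ 2 + (1 - W x) ^ 2) (K := 2 * |v| + K + 1) (a := y) (b := b)
    (fun x hx => (hE x hx.2).continuousAt.continuousWithinAt)
    (fun x hx => (hE x hx.2.le).hasDerivWithinAt) (by simp [hW₁, heq])
    (fun x hx => by
      have hs : 0 ≤ 1 - W x := by linarith [h.le_one hf hx.2.le]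
      have hm : W x ∈ Icc (0 : ℝ) 1 := ⟨h.nonneg x hx.2.le, by linarith⟩
      have hf0 := hf.nonneg hm
      have hfK := hK _ hm
      rw [Real.norm_eq_abs, Real.norm_eq_abs, abs_of_nonneg (a := W₁ x ^ 2 + _) (by positivity)]
      have h1 : |2 * W₁ x * (-v * W₁ x - f (W x)) - 2 * (1 - W x) * W₁ x| ≤
          2 * |v| * W₁ x ^ 2 + 2 * (|W₁ x| * f (W x)) + 2 * (|W₁ x| * (1 - W x)) := by
        have e : 2 * W₁ x * (-v * W₁ x - f (W x)) - 2 * (1 - W x) * W₁ x =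
          -(2 * v * W₁ x ^ 2) - 2 * (W₁ x * f (W x)) - 2 * (W₁ x * (1 - W x)) := by ring
        rw [e]
        refine (abs_sub _ _).trans (add_le_add ((abs_sub _ _).trans (add_le_add ?_ ?_)) ?_)
        · rw [abs_neg, abs_mul, abs_mul, abs_two, abs_of_nonneg (sq_nonneg (W₁ x))]
        · rw [abs_mul, abs_mul, abs_two, abs_of_nonneg hf0]
        · rw [abs_mul, abs_mul, abs_two, abs_of_nonneg hs]
      have h2 : |W₁ x| * f (W x) ≤ |W₁ x| * (K * (1 - W x)) :=
        mul_le_mul_of_nonneg_left hfK (abs_nonneg _)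
      have h3 : 2 * (|W₁ x| * (1 - W x)) ≤ W₁ x ^ 2 + (1 - W x) ^ 2 := by
        rw [← sq_abs (W₁ x)]
        nlinarith [sq_nonneg (|W₁ x| - (1 - W x))]
      have h4 := mul_le_mul_of_nonneg_left h3 hK0.le
      have h5 : 0 ≤ |v| * (1 - W x) ^ 2 := by positivity
      nlinarith) b ⟨hy, le_rfl⟩
  have := h.end_lt_one
  nlinarith [sq_nonneg (W₁ b)]

theorem deriv_neg (h : IsLeftFront f v b W W₁) (hf : IsNormalisedKPP f) {y : ℝ} (hy : y ≤ b) :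
    W₁ y < 0 := by
  refine lt_of_le_of_ne (h.deriv_nonpos hf hy) fun h0 => ?_
  have hzero : ∀ x ≤ y, W₁ x = 0 := fun x hx => by
    have := h.antitoneOn_exp_mul hf (hx.trans hy) hy hx
    simp only [h0, mul_zero] at this
    exact le_antisymm (h.deriv_nonpos hf (hx.trans hy))
      (nonneg_of_mul_nonneg_right this (Real.exp_pos _))
  have hmono : MonotoneOn W (Iic y) := by
    refine monotoneOn_of_deriv_nonneg (convex_Iic y)
      (fun x hx => (h.hasDerivAt x (le_trans hx hy)).continuousAt.continuousWithinAt)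
      (fun x hx => (h.hasDerivAt x
        (le_trans (le_of_mem_interior_Iic hx) hy)).differentiableAt.differentiableWithinAt) fun x hx => ?_
    replace hx := le_of_mem_interior_Iic hx
    rw [(h.hasDerivAt x (le_trans hx hy)).deriv, hzero x hx]
  have : 1 ≤ W y := le_of_tendsto h.tendsto (by
    filter_upwards [eventually_le_atBot y] with x hx using hmono hx (by simp) hx)
  linarith [h.lt_one hf hy]

/-- The front runs on the phase-plane trajectory. -/
theorem deriv_eq (h : IsLeftFront f v b W W₁) (hf : IsNormalisedKPP f)
    (hpos : ∀ y ≤ b, 0 < W y) {p : ℝ → ℝ} (hp : IsTrajectory f v 0 p) {y : ℝ} (hy : y ≤ b) :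
    W₁ y = -p (W y) := by
  have hmem : ∀ x ≤ b, W x ∈ Ioo (0 : ℝ) 1 := fun x hx => ⟨hpos x hx, h.lt_one hf hx⟩
  -- The squared distance to the trajectory does not increase with `y`, so a nonzero value persists
  -- to `-∞`. There `p(W) → 0`, so `W'` would stay below a negative constant, against `W ≤ 1`.
  have hd : ∀ x ≤ b, HasDerivAt (fun x => (W₁ x + p (W x)) ^ 2)
      (-2 * (f (W x) / p (W x)) * (W₁ x + p (W x)) ^ 2) x := fun x hx => by
    have h1 := hp.pos _ (hmem x hx)
    refine (((h.hasDerivAt_deriv x hx).add ((hp.hasDerivAt _ (hmem x hx)).comp x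
      (h.hasDerivAt x hx))).pow 2).congr_deriv ?_
    simp only [Pi.add_apply, Function.comp]
    field_simp
    ring
  have hanti : AntitoneOn (fun x => (W₁ x + p (W x)) ^ 2) (Iic b) := by
    refine antitoneOn_of_deriv_nonpos (convex_Iic b)
      (fun y hy => (hd y hy).continuousAt.continuousWithinAt)
      (fun y hy => (hd y (le_of_mem_interior_Iic hy)).differentiableAt.differentiableWithinAt)
      fun x hx => ?_
    replace hx := le_of_mem_interior_Iic hx
    rw [(hd x hx).deriv]
    have := mul_nonneg (div_nonneg (hf.pos _ (hmem x hx)).le (hp.pos _ (hmem x hx)).le)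
      (sq_nonneg (W₁ x + p (W x)))
    linarith
  by_contra hne
  set c := |W₁ y + p (W y)| with hc
  have hc0 : 0 < c := abs_pos.2 fun h0 => hne (by linarith)
  have hlow : ∀ x ≤ y, c ≤ |W₁ x + p (W x)| := fun x hx =>
    sq_le_sq.1 (hanti (hx.trans hy) hy hx)
  have hpt : Tendsto (fun x => p (W x)) atBot (𝓝 0) := by
    have h1 := hp.continuousOn 1 ⟨one_pos, le_rfl⟩
    rw [ContinuousWithinAt, hp.one] at h1
    refine h1.comp (tendsto_nhdsWithin_iff.2 ⟨h.tendsto, ?_⟩)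
    filter_upwards [eventually_le_atBot b] with x hx using Ioo_subset_Ioc_self (hmem x hx)
  obtain ⟨z, hz⟩ := eventually_atBot.1 ((hpt.eventually (gt_mem_nhds (half_pos hc0))).and
    (eventually_le_atBot y))
  have hW₁ : ∀ x ≤ z, W₁ x ≤ -(c / 2) := fun x hx => by
    obtain ⟨h1, h2⟩ := hz x hx
    have h3 := hlow x h2
    have h4 := h.deriv_nonpos hf (h2.trans hy)
    have h5 := hp.pos _ (hmem x (h2.trans hy))
    rcases le_abs.1 h3 with h6 | h6 <;> linarith
  have hzb : z ≤ b := (hz z le_rfl).2.trans hy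
  have hd2 : ∀ x ≤ z, HasDerivAt (fun x => W x + c / 2 * x) (W₁ x + c / 2) x := fun x hx => by
    have h2 : HasDerivAt (fun y => c / 2 * y) (c / 2) x := by
      simpa using (hasDerivAt_id x).const_mul (c / 2)
    exact (h.hasDerivAt x (hx.trans hzb)).add h2
  have hanti2 : AntitoneOn (fun x => W x + c / 2 * x) (Iic z) := by
    refine antitoneOn_of_deriv_nonpos (convex_Iic z)
      (fun y hy => (hd2 y hy).continuousAt.continuousWithinAt)
      (fun y hy => (hd2 y (le_of_mem_interior_Iic hy)).differentiableAt.differentiableWithinAt)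
      fun x hx => ?_
    rw [(hd2 x (le_of_mem_interior_Iic hx)).deriv]
    linarith [hW₁ x (le_of_mem_interior_Iic hx)]
  -- Moving left by `2/c` at slope at most `-c/2` raises the positive value `W z` by at least `1`.
  have hle : z - 2 / c ≤ z := by
    have : 0 < 2 / c := by positivity
    linarith
  have h1 := hanti2 (show z - 2 / c ∈ Iic z from hle) self_mem_Iic hle
  have h2 : c / 2 * (z - 2 / c) = c / 2 * z - 1 := by field_simp
  simp only [h2] at h1
  linarith [h.le_one hf (hle.trans hzb), hpos z hzb]

end IsLeftFront

/-! ### The minimum speed without cut-off -/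

theorem contDiffOn_two_of_hasDerivAt {U U₁ U₂ : ℝ → ℝ} {s : Set ℝ} (hs : IsOpen s)
    (h₁ : ∀ y ∈ s, HasDerivAt U (U₁ y) y) (h₂ : ∀ y ∈ s, HasDerivAt U₁ (U₂ y) y)
    (hc : ContinuousOn U₂ s) : ContDiffOn ℝ 2 U s := by
  have e₁ : EqOn (deriv U) U₁ s := fun y hy => (h₁ y hy).deriv
  have e₂ : EqOn (deriv U₁) U₂ s := fun y hy => (h₂ y hy).deriv
  have hU₁ : ContDiffOn ℝ 1 U₁ s := by
    rw [show (1 : WithTop ℕ∞) = 0 + 1 by norm_num, contDiffOn_succ_iff_deriv_of_isOpen hs]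
    refine ⟨fun y hy => (h₂ y hy).differentiableAt.differentiableWithinAt, by simp, ?_⟩
    exact contDiffOn_zero.2 (hc.congr e₂)
  rw [show (2 : WithTop ℕ∞) = 1 + 1 by norm_num, contDiffOn_succ_iff_deriv_of_isOpen hs]
  exact ⟨fun y hy => (h₁ y hy).differentiableAt.differentiableWithinAt, by simp, hU₁.congr e₁⟩

theorem ContDiffOn.differentiableAt_deriv {U : ℝ → ℝ} {s : Set ℝ} (h : ContDiffOn ℝ 2 U s)
    (hs : IsOpen s) {y : ℝ} (hy : y ∈ s) : DifferentiableAt ℝ (deriv U) y := by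
  rw [show (2 : WithTop ℕ∞) = 1 + 1 by norm_num, contDiffOn_succ_iff_deriv_of_isOpen hs] at h
  exact (h.2.2.differentiableOn one_ne_zero).differentiableAt (hs.mem_nhds hy)

theorem IsNormalisedKPP.exists_isKPPWave_two {f : ℝ → ℝ} (hf : IsNormalisedKPP f) :
    ∃ U, IsKPPWave f 2 U := by
  obtain ⟨p, hp⟩ := hf.exists_isTrajectory zero_le_two
  obtain ⟨K, hK0, hK⟩ := hf.exists_le_mul_one_sub
  have hpc : ContinuousOn p (Ioo 0 1) := hp.continuousOn.mono Ioo_subset_Ioc_self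
  obtain ⟨U, -, hU, hUd, hUb, hUt, -⟩ := exists_profile (M := K + 1) (u₀ := 1 / 2) hpc hp.pos
    (fun u hu => (hp.le_self_of_two hf (Ioo_subset_Ioc_self hu)).trans (by nlinarith [hu.1]))
    (fun u hu => hp.le_linear zero_le_two (by linarith) hu.1 (fun x hx =>
      (hK x ⟨(hu.1.trans hx.1).le, hx.2.le⟩).trans
        (mul_le_mul_of_nonneg_right (by nlinarith) (by linarith [hx.2]))) u ⟨le_rfl, hu.2.le⟩)
    ⟨by norm_num, by norm_num⟩
  have hUc : Continuous U := continuous_iff_continuousAt.2 fun y => (hUd y).continuousAt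
  have hdU : deriv U = fun y => -p (U y) := funext fun y => (hUd y).deriv
  have hd2 : ∀ y, HasDerivAt (fun y => -p (U y)) (2 * p (U y) - f (U y)) y := fun y => by
    have h0 := hp.pos _ (hU y)
    refine ((hp.hasDerivAt _ (hU y)).comp y (hUd y)).neg.congr_deriv ?_
    field_simp
  refine ⟨U, zero_le_two, ?_, fun y => ?_, fun y => (hU y).1.le, hUb, hUt⟩
  · rw [← contDiffOn_univ]
    refine contDiffOn_two_of_hasDerivAt isOpen_univ (fun y _ => hUd y) (fun y _ => hd2 y) ?_
    exact ((continuous_const.mul (hpc.comp_continuous hUc hU)).sub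
      (hf.continuous.comp hUc)).continuousOn
  · rw [hdU, (hd2 y).deriv]
    ring

/-- Below speed `2` the origin is a spiral point. For `r = -W'/W` one has `r' = (r - v/2)² + G(W) -
v²/4`, so eventually `arctan ((r - v/2)/k)` grows at rate at least `k`; this is impossible over a
length `π/k`. -/
theorem IsKPPWave.two_le {f W : ℝ → ℝ} {v : ℝ} (h : IsKPPWave f v W) (hf : IsNormalisedKPP f) :
    2 ≤ v := by
  by_contra! hv2
  have hv := h.speed_nonneg
  have hd : ∀ y, HasDerivAt W (deriv W y) y := fun y =>
    (h.contDiff_two.differentiable two_ne_zero y).hasDerivAt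
  have hdd : ∀ y, HasDerivAt (deriv W) (-v * deriv W y - f (W y)) y := fun y => by
    refine ((contDiffOn_univ.2 h.contDiff_two).differentiableAt_deriv isOpen_univ
      (mem_univ y)).hasDerivAt.congr_deriv ?_
    linarith [h.ode y]
  have hfront : ∀ y, ∃ b, y ≤ b ∧ IsLeftFront f v b W (deriv W) := fun y => by
    obtain ⟨b, hb1, hb2⟩ := ((h.tendsto_right.eventually (gt_mem_nhds one_pos)).and
      (eventually_ge_atTop y)).exists
    exact ⟨b, hb2, fun y _ => hd y, fun y _ => hdd y, fun y _ => h.nonneg y, hb1, h.tendsto_left⟩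
  have hneg : ∀ y, deriv W y < 0 := fun y => by
    obtain ⟨b, hyb, hb⟩ := hfront y
    exact hb.deriv_neg hf hyb
  have hanti : StrictAnti W := strictAnti_of_deriv_neg hneg
  have hpos : ∀ y, 0 < W y := fun y =>
    (h.nonneg (y + 1)).trans_lt (hanti (by linarith : y < y + 1))
  obtain ⟨G, hG, hfG, hG0⟩ := hf.exists_factor_zero
  -- Midpoint of `v²/4` and `1 = G 0`: eventually `G(W) > a`, while `k² = a - v²/4 > 0`.
  set a := (1 + v ^ 2 / 4) / 2 with ha
  have ha1 : a < 1 := by rw [ha]; nlinarith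
  set k := Real.sqrt (a - v ^ 2 / 4) with hk
  have hk2 : 0 < a - v ^ 2 / 4 := by rw [ha]; nlinarith
  have hk0 : 0 < k := Real.sqrt_pos.2 hk2
  have hksq : k ^ 2 = a - v ^ 2 / 4 := Real.sq_sqrt hk2.le
  have hGW : Tendsto (fun y => G (W y)) atTop (𝓝 1) := by
    rw [← hG0]
    exact (hG.tendsto 0).comp h.tendsto_right
  obtain ⟨y₀, hy₀⟩ := eventually_atTop.1 (hGW.eventually (lt_mem_nhds ha1))
  set w : ℝ → ℝ := fun y => (-deriv W y / W y - v / 2) / k with hw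
  have hwd : ∀ y, HasDerivAt w (((-deriv W y / W y - v / 2) ^ 2 + (G (W y) - v ^ 2 / 4)) / k) y := by
    intro y
    have h1 := ((((hdd y).neg.div (hd y) (hpos y).ne').sub_const (v / 2)).div_const k)
    refine h1.congr_deriv ?_
    have := hpos y
    rw [hfG]
    simp only [Pi.neg_apply]
    field_simp
    ring
  have hφ : ∀ y, HasDerivAt (fun y => Real.arctan (w y) - k * y)
      (1 / (1 + w y ^ 2) * (((-deriv W y / W y - v / 2) ^ 2 + (G (W y) - v ^ 2 / 4)) / k) - k) y := by
    intro y
    have h2 : HasDerivAt (fun y => k * y) k y := by simpa using (hasDerivAt_id y).const_mul k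
    exact (hwd y).arctan.sub h2
  have hmono : MonotoneOn (fun y => Real.arctan (w y) - k * y) (Ici y₀) := by
    refine monotoneOn_of_deriv_nonneg (convex_Ici y₀)
      (fun y _ => (hφ y).continuousAt.continuousWithinAt)
      (fun y _ => (hφ y).differentiableAt.differentiableWithinAt) fun y hy => ?_
    rw [(hφ y).deriv, sub_nonneg]
    have hGy := hy₀ y (interior_subset hy)
    simp only [hw]
    set z := -deriv W y / W y - v / 2
    have : 1 / (1 + (z / k) ^ 2) * ((z ^ 2 + (G (W y) - v ^ 2 / 4)) / k) =
        k * ((z ^ 2 + (G (W y) - v ^ 2 / 4)) / (z ^ 2 + k ^ 2)) := by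
      field_simp
      ring
    rw [this]
    refine le_mul_of_one_le_right hk0.le ((one_le_div (by positivity)).2 ?_)
    linarith
  have h1 := hmono self_mem_Ici
    (show y₀ + Real.pi / k ∈ Ici y₀ by
      have : 0 < Real.pi / k := by positivity
      simp only [mem_Ici]; linarith)
    (by have : 0 < Real.pi / k := by positivity
        linarith)
  have h2 : k * (y₀ + Real.pi / k) = k * y₀ + Real.pi := by field_simp
  simp only [h2] at h1
  linarith [Real.arctan_lt_pi_div_two (w (y₀ + Real.pi / k)), Real.neg_pi_div_two_lt_arctan (w y₀)]

theorem IsNormalisedKPP.isLeast_speed {f : ℝ → ℝ} (hf : IsNormalisedKPP f) :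
    IsLeast {v : ℝ | ∃ W : ℝ → ℝ, IsKPPWave f v W} 2 :=
  ⟨hf.exists_isKPPWave_two, fun _ ⟨_, hW⟩ => hW.two_le hf⟩

/-! ### Cut-off waves on either side of the boundary -/

theorem cutoff_of_lt {f : ℝ → ℝ} {uc u : ℝ} (h : uc < u) : cutoff f uc u = f u := if_pos h

theorem cutoff_of_le {f : ℝ → ℝ} {uc u : ℝ} (h : u ≤ uc) : cutoff f uc u = 0 :=
  if_neg (not_lt.2 h)

theorem eq_of_hasDerivAt_zero_of_nonneg {g : ℝ → ℝ} (hc : Continuous g)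
    (hd : ∀ y, 0 < y → HasDerivAt g 0 y) {y : ℝ} (hy : 0 ≤ y) : g y = g 0 := by
  rcases eq_or_lt_of_le hy with rfl | hy
  · rfl
  obtain ⟨c, hc', he⟩ := exists_hasDerivAt_eq_slope g (fun _ => 0) hy hc.continuousOn
    fun x hx => hd x hx.1
  rw [eq_comm, div_eq_zero_iff] at he
  rcases he with he | he <;> linarith

namespace IsCutoffWave

variable {f W p : ℝ → ℝ} {uc v : ℝ}

theorem hasDerivAt (h : IsCutoffWave f uc v W) (y : ℝ) : HasDerivAt W (deriv W y) y :=
  (h.contDiff_one.differentiable one_ne_zero y).hasDerivAt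

theorem continuous (h : IsCutoffWave f uc v W) : Continuous W := h.contDiff_one.continuous

theorem continuous_deriv (h : IsCutoffWave f uc v W) : Continuous (deriv W) :=
  h.contDiff_one.continuous_deriv le_rfl

theorem hasDerivAt_deriv (h : IsCutoffWave f uc v W) {y : ℝ} (hy : y ≠ 0) :
    HasDerivAt (deriv W) (-v * deriv W y - cutoff f uc (W y)) y := by
  refine (h.contDiffOn_two.differentiableAt_deriv isOpen_compl_singleton
    hy).hasDerivAt.congr_deriv ?_
  linarith [h.ode y hy]

/-- On `y < 0` continuity of `W''` makes `cutoff f uc (W y)` continuous. At a first contact with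
`uc` it would jump from `f uc > 0` to `0`. -/
theorem lt_left (h : IsCutoffWave f uc v W) (hf : IsNormalisedKPP f) (huc : uc ∈ Ioo (0 : ℝ) 1)
    {y : ℝ} (hy : y < 0) : uc < W y := by
  refine lt_of_le_of_ne (h.left y hy) fun heq => ?_
  obtain ⟨a, ha, hay⟩ := ((h.tendsto_left.eventually (lt_mem_nhds huc.2)).and
    (eventually_le_atBot y)).exists
  have hcomp : IsCompact (Icc a y ∩ W ⁻¹' {uc}) :=
    isCompact_Icc.inter_right (isClosed_singleton.preimage h.continuous)
  obtain ⟨c, ⟨hc1, hc2⟩, hc3⟩ := hcomp.exists_isLeast ⟨y, ⟨hay, le_rfl⟩, heq.symm⟩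
  have hc2 : W c = uc := hc2
  have hac : a < c := lt_of_le_of_ne hc1.1 (by rintro rfl; linarith)
  have hc0 : c < 0 := hc1.2.trans_lt hy
  have hcont : ContinuousAt (fun x => cutoff f uc (W x)) c := by
    have h1 : ContDiffOn ℝ 1 (deriv W) {0}ᶜ := by
      have := h.contDiffOn_two
      rw [show (2 : WithTop ℕ∞) = 1 + 1 by norm_num,
        contDiffOn_succ_iff_deriv_of_isOpen isOpen_compl_singleton] at this
      exact this.2.2
    have h2 : ContinuousAt (deriv (deriv W)) c :=
      (h1.continuousOn_deriv_of_isOpen isOpen_compl_singleton le_rfl).continuousAt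
        (isOpen_compl_singleton.mem_nhds hc0.ne)
    have h3 : ContinuousAt (fun x => -deriv (deriv W) x - v * deriv W x) c :=
      h2.neg.sub (h.continuous_deriv.continuousAt.const_mul v)
    refine h3.congr ?_
    filter_upwards [gt_mem_nhds hc0] with x hx
    linarith [h.ode x hx.ne]
  have h1 : Tendsto (fun x => cutoff f uc (W x)) (𝓝[<] c) (𝓝 0) := by
    have := hcont.tendsto.mono_left (nhdsWithin_le_nhds (s := Iio c))
    rwa [cutoff_of_le hc2.le] at this
  have h2 : Tendsto (fun x => cutoff f uc (W x)) (𝓝[<] c) (𝓝 (f uc)) := by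
    have h3 : Tendsto (fun x => f (W x)) (𝓝[<] c) (𝓝 (f (W c))) :=
      ((hf.continuous.comp h.continuous).tendsto c).mono_left nhdsWithin_le_nhds
    rw [hc2] at h3
    refine h3.congr' ?_
    filter_upwards [Ioo_mem_nhdsLT hac] with x hx
    refine (cutoff_of_lt (lt_of_le_of_ne (h.left x (hx.2.trans hc0)) fun he => ?_)).symm
    exact absurd (hc3 ⟨⟨hx.1.le, hx.2.le.trans hc1.2⟩, he.symm⟩) (not_le.2 hx.2)
  exact (hf.pos uc huc).ne (tendsto_nhds_unique h1 h2)

theorem exists_isLeftFront (h : IsCutoffWave f uc v W) (hf : IsNormalisedKPP f)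
    (huc : uc ∈ Ioo (0 : ℝ) 1) {y : ℝ} (hy : y < 0) :
    ∃ b, y ≤ b ∧ b < 0 ∧ IsLeftFront f v b W (deriv W) := by
  have h0 : ∀ᶠ x in 𝓝[<] (0 : ℝ), W x < 1 :=
    (h.continuous.tendsto 0).mono_left nhdsWithin_le_nhds |>.eventually
      (gt_mem_nhds (by rw [h.at_zero]; exact huc.2))
  obtain ⟨b, hb1, hb2⟩ := (h0.and (Ioo_mem_nhdsLT hy)).exists
  refine ⟨b, hb2.1.le, hb2.2, fun x _ => h.hasDerivAt x, fun x hx => ?_,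
    fun x hx => huc.1.le.trans (h.left x (hx.trans_lt hb2.2)), hb1, h.tendsto_left⟩
  have hx0 := hx.trans_lt hb2.2
  rw [← cutoff_of_lt (f := f) (h.lt_left hf huc hx0)]
  exact h.hasDerivAt_deriv hx0.ne

theorem mem_left (h : IsCutoffWave f uc v W) (hf : IsNormalisedKPP f)
    (huc : uc ∈ Ioo (0 : ℝ) 1) {y : ℝ} (hy : y < 0) : W y ∈ Ioo uc 1 := by
  obtain ⟨b, hyb, -, hb⟩ := h.exists_isLeftFront hf huc hy
  exact ⟨h.lt_left hf huc hy, hb.lt_one hf hyb⟩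

theorem deriv_left (h : IsCutoffWave f uc v W) (hf : IsNormalisedKPP f)
    (huc : uc ∈ Ioo (0 : ℝ) 1) (hp : IsTrajectory f v 0 p) {y : ℝ} (hy : y < 0) :
    deriv W y = -p (W y) := by
  obtain ⟨b, hyb, hb0, hb⟩ := h.exists_isLeftFront hf huc hy
  exact hb.deriv_eq hf (fun x hx => huc.1.trans (h.lt_left hf huc (hx.trans_lt hb0))) hp hyb

/-- Continuity of `W'` carries the trajectory relation to `y = 0`. Together with `right_eq` it
yields the matching condition `p uc = v * uc`. -/
theorem deriv_zero_eq (h : IsCutoffWave f uc v W) (hf : IsNormalisedKPP f)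
    (huc : uc ∈ Ioo (0 : ℝ) 1) (hp : IsTrajectory f v 0 p) : deriv W 0 = -p uc := by
  have h1 : Tendsto (deriv W) (𝓝[<] 0) (𝓝 (deriv W 0)) :=
    (h.continuous_deriv.tendsto 0).mono_left nhdsWithin_le_nhds
  have h2 : ContinuousAt (fun y => -p (W y)) 0 := by
    refine (ContinuousAt.comp (g := p) ?_ h.continuous.continuousAt).neg
    rw [h.at_zero]
    exact (hp.hasDerivAt uc huc).continuousAt
  have h3 : Tendsto (fun y => -p (W y)) (𝓝[<] 0) (𝓝 (-p uc)) := by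
    have := h2.tendsto.mono_left (nhdsWithin_le_nhds (s := Iio 0))
    rwa [h.at_zero] at this
  refine tendsto_nhds_unique h1 (h3.congr' ?_)
  filter_upwards [self_mem_nhdsWithin] with y hy using (h.deriv_left hf huc hp hy).symm

/-- For `y > 0` the equation is `W'' + v W' = 0`, which conserves `exp (v y) W'` and `W' + v W`. If
`v = 0` then `W` is affine there, incompatible with its values at `0` and infinity; if `v > 0`,
decay makes the second constant zero. -/
theorem right_eq (h : IsCutoffWave f uc v W) (huc : 0 < uc) :
    0 < v ∧ deriv W 0 = -(v * uc) ∧ ∀ y, 0 ≤ y → W y = uc * Real.exp (-v * y) := by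
  have hdd : ∀ y, 0 < y → HasDerivAt (deriv W) (-v * deriv W y) y := fun y hy => by
    have := h.hasDerivAt_deriv hy.ne'
    rwa [cutoff_of_le (h.right y hy).2, sub_zero] at this
  have hlin : ∀ y, HasDerivAt (fun y => v * y) v y := fun y => by
    simpa using (hasDerivAt_id y).const_mul v
  have hA : ∀ y, 0 ≤ y → Real.exp (v * y) * deriv W y = deriv W 0 := fun y hy => by
    have := eq_of_hasDerivAt_zero_of_nonneg (g := fun y => Real.exp (v * y) * deriv W y)
      ((by fun_prop : Continuous fun y => Real.exp (v * y)).mul h.continuous_deriv)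
      (fun y hy => ((hlin y).exp.mul (hdd y hy)).congr_deriv (by ring)) hy
    simpa using this
  have hB : ∀ y, 0 ≤ y → deriv W y + v * W y = deriv W 0 + v * uc := fun y hy => by
    have := eq_of_hasDerivAt_zero_of_nonneg (g := fun y => deriv W y + v * W y)
      (h.continuous_deriv.add (continuous_const.mul h.continuous))
      (fun y hy => ((hdd y hy).add ((h.hasDerivAt y).const_mul v)).congr_deriv (by ring)) hy
    simpa [h.at_zero] using this
  have hv : 0 < v := by
    refine lt_of_le_of_ne h.speed_nonneg fun h0 => ?_
    subst h0
    have hC : ∀ y, 0 ≤ y → W y - deriv W 0 * y = uc := fun y hy => by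
      have hl : ∀ y, HasDerivAt (fun y => deriv W 0 * y) (deriv W 0) y := fun y => by
        simpa using (hasDerivAt_id y).const_mul (deriv W 0)
      have := eq_of_hasDerivAt_zero_of_nonneg (g := fun y => W y - deriv W 0 * y)
        (h.continuous.sub (by fun_prop))
        (fun y hy => ((h.hasDerivAt y).sub (hl y)).congr_deriv (by
          have := hB y hy.le
          simp only [zero_mul, add_zero] at this
          linarith)) hy
      simpa [h.at_zero] using this
    have h1 : Tendsto (fun y => W (y + 1) - W y) atTop (𝓝 (0 - 0)) :=
      (h.tendsto_right.comp (tendsto_atTop_add_const_right _ 1 tendsto_id)).sub h.tendsto_right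
    have h2 : Tendsto (fun y => W (y + 1) - W y) atTop (𝓝 (deriv W 0)) := by
      refine tendsto_const_nhds.congr' ?_
      filter_upwards [eventually_ge_atTop 0] with y hy
      linarith [hC y hy, hC (y + 1) (by linarith)]
    have h3 : deriv W 0 = 0 := by simpa using tendsto_nhds_unique h2 h1
    have h4 : Tendsto W atTop (𝓝 uc) := by
      refine tendsto_const_nhds.congr' ?_
      filter_upwards [eventually_ge_atTop 0] with y hy
      have := hC y hy
      rw [h3] at this
      linarith
    exact huc.ne (tendsto_nhds_unique h.tendsto_right h4)
  have hder : ∀ y, 0 ≤ y → deriv W y = deriv W 0 * Real.exp (-v * y) := fun y hy => by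
    rw [← hA y hy, mul_right_comm, ← Real.exp_add]
    simp
  have hexp : Tendsto (fun y => Real.exp (-v * y)) atTop (𝓝 0) :=
    Real.tendsto_exp_atBot.comp (tendsto_id.const_mul_atTop_of_neg (neg_lt_zero.2 hv))
  have hlim : Tendsto (fun y => deriv W 0 * Real.exp (-v * y) + v * W y) atTop (𝓝 0) := by
    simpa using (hexp.const_mul (deriv W 0)).add (h.tendsto_right.const_mul v)
  have h0 : deriv W 0 + v * uc = 0 := by
    refine tendsto_nhds_unique (tendsto_const_nhds.congr' ?_) hlim
    filter_upwards [eventually_ge_atTop 0] with y hy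
    rw [← hder y hy, hB y hy]
  refine ⟨hv, by linarith, fun y hy => ?_⟩
  have h1 := hB y hy
  rw [hder y hy, h0, show deriv W 0 = -(v * uc) by linarith] at h1
  have h2 : v * (W y - uc * Real.exp (-v * y)) = 0 := by linarith
  rcases mul_eq_zero.1 h2 with h3 | h3
  · exact absurd h3 hv.ne'
  · linarith

end IsCutoffWave

/-! ### Existence and uniqueness of the wave at the selected speed -/

/-- The phase-plane slope of the cut-off wave: linear below the cut-off, equal to the trajectory
`p` above it. -/
noncomputable def cutoffSlope (p : ℝ → ℝ) (uc v u : ℝ) : ℝ :=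
  v * min u uc + p (max u uc) - v * uc

theorem cutoffSlope_of_le {p : ℝ → ℝ} {uc v u : ℝ} (hp : p uc = v * uc) (hu : u ≤ uc) :
    cutoffSlope p uc v u = v * u := by
  rw [cutoffSlope, min_eq_left hu, max_eq_right hu, hp]; ring

theorem cutoffSlope_of_ge {p : ℝ → ℝ} {uc v u : ℝ} (hu : uc ≤ u) :
    cutoffSlope p uc v u = p u := by
  rw [cutoffSlope, min_eq_right hu, max_eq_left hu]; ring

theorem IsCutoffWave.hasDerivAt_cutoffSlope {f W p : ℝ → ℝ} {uc v : ℝ}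
    (h : IsCutoffWave f uc v W) (hf : IsNormalisedKPP f) (huc : uc ∈ Ioo (0 : ℝ) 1)
    (hp : IsTrajectory f v 0 p) (hpu : p uc = v * uc) (y : ℝ) :
    W y ∈ Ioo (0 : ℝ) 1 ∧ HasDerivAt W (-cutoffSlope p uc v (W y)) y := by
  obtain ⟨hv, -, hW⟩ := h.right_eq huc.1
  rcases lt_or_ge y 0 with hy | hy
  · have hm := h.mem_left hf huc hy
    refine ⟨⟨huc.1.trans hm.1, hm.2⟩, ?_⟩
    rw [cutoffSlope_of_ge hm.1.le, ← h.deriv_left hf huc hp hy]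
    exact h.hasDerivAt y
  · have hle : W y ≤ uc := by
      rw [hW y hy]
      exact mul_le_of_le_one_right huc.1.le (Real.exp_le_one_iff.2 (by nlinarith))
    have hpos : 0 < W y := by
      rw [hW y hy]
      exact mul_pos huc.1 (Real.exp_pos _)
    refine ⟨⟨hpos, hle.trans_lt huc.2⟩, ?_⟩
    rw [cutoffSlope_of_le hpu hle]
    refine (h.hasDerivAt y).congr_deriv ?_
    rcases eq_or_lt_of_le hy with rfl | hy'
    · rw [h.deriv_zero_eq hf huc hp, h.at_zero, hpu]
    · have heq : W =ᶠ[𝓝 y] fun y => uc * Real.exp (-v * y) := by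
        filter_upwards [lt_mem_nhds hy'] with x hx using hW x hx.le
      have hl : HasDerivAt (fun y => -v * y) (-v) y := by
        simpa using (hasDerivAt_id y).const_mul (-v)
      rw [heq.deriv_eq, (hl.exp.const_mul uc).deriv, hW y hy]
      ring

/-- At a speed whose trajectory meets the line `p = v u` over the cut-off there is exactly one
cut-off wave. -/
theorem existsUnique_isCutoffWave {f p : ℝ → ℝ} {uc v : ℝ} (hf : IsNormalisedKPP f)
    (huc : uc ∈ Ioo (0 : ℝ) 1) (hv : 0 < v) (hp : IsTrajectory f v 0 p) (hpu : p uc = v * uc) :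
    ∃! U, IsCutoffWave f uc v U := by
  obtain ⟨K, hK0, hK⟩ := hf.exists_le_mul_one_sub
  set P := cutoffSlope p uc v with hP
  have hmax : ∀ u ∈ Ioo (0 : ℝ) 1, max u uc ∈ Ioo (0 : ℝ) 1 := fun u hu =>
    ⟨lt_max_of_lt_left hu.1, max_lt hu.2 huc.2⟩
  have hpc : ContinuousOn p (Ioo 0 1) := hp.continuousOn.mono Ioo_subset_Ioc_self
  have hPc : ContinuousOn P (Ioo 0 1) := by
    have : ContinuousOn (fun u => p (max u uc)) (Ioo 0 1) := hpc.comp (by fun_prop) hmax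
    exact ((by fun_prop : ContinuousOn (fun u => v * min u uc) (Ioo 0 1)).add this).sub
      continuousOn_const
  have hPpos : ∀ u ∈ Ioo (0 : ℝ) 1, 0 < P u := fun u hu => by
    rcases le_total u uc with h | h
    · rw [hP, cutoffSlope_of_le hpu h]; exact mul_pos hv hu.1
    · rw [hP, cutoffSlope_of_ge h]; exact hp.pos u hu
  have huc1 : 0 < 1 - uc := by linarith [huc.2]
  have hvM : v ≤ v / (1 - uc) := by
    rw [le_div_iff₀ huc1]
    nlinarith [huc.1]
  -- `M` must exceed `v` for the bound at `0`, `v/(1 - uc)` for the bound at `1` below the cut-off,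
  -- and satisfy `K ≤ M (v + M)` for `le_linear` above it.
  set M := K + 1 + v / (1 - uc) with hM
  have hvM' : v ≤ M := by rw [hM]; linarith
  have hP0 : ∀ u ∈ Ioo (0 : ℝ) 1, P u ≤ M * u := fun u hu => by
    refine le_trans ?_ (mul_le_mul_of_nonneg_right hvM' hu.1.le)
    rcases le_total u uc with h | h
    · rw [hP, cutoffSlope_of_le hpu h]
    · rw [hP, cutoffSlope_of_ge h]
      have := (hp.strictAntiOn_sub hf).antitoneOn (Ioo_subset_Ioc_self huc)
        (Ioo_subset_Ioc_self hu) h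
      linarith
  have hP1 : ∀ u ∈ Ioo (0 : ℝ) 1, P u ≤ M * (1 - u) := fun u hu => by
    have hu1 : 0 ≤ 1 - u := by linarith [hu.2]
    rcases le_total u uc with h | h
    · rw [hP, cutoffSlope_of_le hpu h]
      have h1 : v ≤ v / (1 - uc) * (1 - u) := by
        rw [div_mul_eq_mul_div, le_div_iff₀ huc1]
        exact mul_le_mul_of_nonneg_left (by linarith) hv.le
      have h2 : 0 ≤ (K + 1) * (1 - u) := by positivity
      have h3 : v * u ≤ v := mul_le_of_le_one_right hv.le hu.2.le
      rw [hM, add_mul]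
      linarith
    · rw [hP, cutoffSlope_of_ge h]
      have hKM : K ≤ M * (v + M) := by
        have : K + 1 ≤ M := by rw [hM]; linarith
        nlinarith
      exact hp.le_linear hv.le (hv.trans_le hvM') hu.1 (fun x hx =>
        (hK x ⟨(hu.1.trans hx.1).le, hx.2.le⟩).trans
          (mul_le_mul_of_nonneg_right hKM (by linarith [hx.2]))) u ⟨le_rfl, hu.2.le⟩
  obtain ⟨U, hU0, hU, hUd, hUb, hUt, huniq⟩ := exists_profile hPc hPpos hP0 hP1 huc
  have hUanti : StrictAnti U := strictAnti_of_deriv_neg fun y => by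
    rw [(hUd y).deriv]
    linarith [hPpos _ (hU y)]
  have hUc : Continuous U := continuous_iff_continuousAt.2 fun y => (hUd y).continuousAt
  have hUl : ∀ y, y < 0 → uc < U y := fun y hy => by rw [← hU0]; exact hUanti hy
  have hUr : ∀ y, 0 < y → U y < uc := fun y hy => by rw [← hU0]; exact hUanti hy
  have hdU : deriv U = fun y => -P (U y) := funext fun y => (hUd y).deriv
  have hdUc : Continuous fun y => -P (U y) := (hPc.comp_continuous hUc hU).neg
  have hd2 : ∀ y ∈ ({0}ᶜ : Set ℝ),
      HasDerivAt (fun y => -P (U y)) (v * P (U y) - cutoff f uc (U y)) y := by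
    intro y hy
    rcases lt_or_gt_of_ne hy with hy | hy
    · have hl := hUl y hy
      have heq : P =ᶠ[𝓝 (U y)] p := by
        filter_upwards [lt_mem_nhds hl] with u hu using cutoffSlope_of_ge hu.le
      have h0 := hp.pos _ (hU y)
      refine ((((hp.hasDerivAt _ (hU y)).congr_of_eventuallyEq heq).comp y
        (hUd y)).neg).congr_deriv ?_
      rw [cutoff_of_lt hl, heq.eq_of_nhds]
      field_simp
    · have hl := hUr y hy
      have heq : P =ᶠ[𝓝 (U y)] fun u => v * u := by
        filter_upwards [gt_mem_nhds hl] with u hu using cutoffSlope_of_le hpu hu.le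
      have hlin : HasDerivAt (fun u => v * u) v (U y) := by
        simpa using (hasDerivAt_id (U y)).const_mul v
      refine (((hlin.congr_of_eventuallyEq heq).comp y (hUd y)).neg).congr_deriv ?_
      rw [cutoff_of_le hl.le]
      ring
  have hcut : ContinuousOn (fun y => cutoff f uc (U y)) {0}ᶜ := by
    intro y hy
    refine ContinuousAt.continuousWithinAt ?_
    rcases lt_or_gt_of_ne hy with hy | hy
    · refine (hf.continuous.comp hUc).continuousAt.congr ?_
      filter_upwards [gt_mem_nhds hy] with x hx using (cutoff_of_lt (hUl x hx)).symm
    · refine (continuousAt_const (y := (0 : ℝ))).congr ?_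
      filter_upwards [lt_mem_nhds hy] with x hx using (cutoff_of_le (hUr x hx).le).symm
  refine ⟨U, ⟨hv.le, ?_, ?_, fun y hy => ?_, fun y hy => (hUl y hy).le,
    fun y hy => ⟨(hU y).1.le, (hUr y hy).le⟩, hU0, hUb, hUt⟩, fun W hW => ?_⟩
  · rw [contDiff_one_iff_deriv, hdU]
    exact ⟨fun y => (hUd y).differentiableAt, hdUc⟩
  · exact contDiffOn_two_of_hasDerivAt isOpen_compl_singleton (fun y _ => hUd y) hd2
      ((continuousOn_const.mul (hPc.comp_continuous hUc hU).continuousOn).sub hcut)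
  · rw [hdU, (hd2 y hy).deriv]
    ring
  · have hWd := hW.hasDerivAt_cutoffSlope hf huc hp hpu
    exact huniq W hW.at_zero (fun y => (hWd y).1) fun y => (hWd y).2

/-! ### Asymptotics at minus infinity and the jump at the boundary -/

/-- A function whose derivative tends to `l` at `-∞` grows linearly with slope `l` there. -/
theorem tendsto_div_of_tendsto_deriv_atBot {L L' : ℝ → ℝ} {l : ℝ}
    (hd : ∀ y < 0, HasDerivAt L (L' y) y) (hl : Tendsto L' atBot (𝓝 l)) :
    Tendsto (fun y => L y / y) atBot (𝓝 l) := by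
  rw [Metric.tendsto_nhds]
  intro ε hε
  obtain ⟨y₀, hy₀⟩ := eventually_atBot.1 ((Metric.tendsto_nhds.1 hl (ε / 2) (half_pos hε)).and
    (eventually_lt_atBot 0))
  have hy₀0 : y₀ < 0 := (hy₀ y₀ le_rfl).2
  have hbound : ∀ y ≤ y₀, |(L y - l * y) - (L y₀ - l * y₀)| ≤ ε / 2 * |y - y₀| := fun y hy => by
    refine Convex.norm_image_sub_le_of_norm_hasDerivWithin_le (f := fun y => L y - l * y)
      (f' := fun y => L' y - l) (s := Iic y₀) (fun x hx => ?_) (fun x hx => ?_) (convex_Iic y₀)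
      self_mem_Iic hy
    · have hlin : HasDerivAt (fun y => l * y) l x := by
        simpa using (hasDerivAt_id x).const_mul l
      exact ((hd x (hy₀ x hx).2).sub hlin).hasDerivWithinAt
    · exact (hy₀ x hx).1.le
  have hsmall : ∀ᶠ y : ℝ in atBot, |L y₀ - l * y₀| / (ε / 2) < -y :=
    tendsto_neg_atBot_atTop.eventually_gt_atTop _
  filter_upwards [hsmall, eventually_le_atBot y₀] with y h1 h2
  have hy0 : y < 0 := h2.trans_lt hy₀0
  rw [div_lt_iff₀ (half_pos hε)] at h1
  have h3 := hbound y h2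
  rw [abs_of_nonpos (a := y - y₀) (by linarith)] at h3
  rw [Real.dist_eq, show L y / y - l = (L y - l * y) / y by field_simp [hy0.ne], abs_div,
    abs_of_neg hy0, div_lt_iff₀ (by linarith)]
  have h4 := abs_sub_abs_le_abs_sub (L y - l * y) (L y₀ - l * y₀)
  nlinarith

/-- If the derivative of `h` is dominated by that of a function `g ≥ 0` on a neighbourhood of `-∞`,
then `h` converges at `-∞` whenever `g → 0` there. -/
theorem exists_tendsto_atBot_of_abs_deriv_le {h h' g g' : ℝ → ℝ} {y₀ : ℝ}
    (hh : ∀ y ≤ y₀, HasDerivAt h (h' y) y) (hg : ∀ y ≤ y₀, HasDerivAt g (g' y) y)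
    (hle : ∀ y ≤ y₀, |h' y| ≤ g' y) (hg0 : ∀ y ≤ y₀, 0 ≤ g y) (hgt : Tendsto g atBot (𝓝 0)) :
    ∃ l, Tendsto h atBot (𝓝 l) := by
  have hmono : MonotoneOn (fun y => h y + g y) (Iic y₀) := by
    refine monotoneOn_of_deriv_nonneg (convex_Iic y₀)
      (fun y hy => ((hh y hy).add (hg y hy)).continuousAt.continuousWithinAt)
      (fun y hy => ((hh y (le_of_mem_interior_Iic hy)).add
        (hg y (le_of_mem_interior_Iic hy))).differentiableAt.differentiableWithinAt) fun y hy => ?_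
    replace hy := le_of_mem_interior_Iic hy
    rw [HasDerivAt.deriv (f := fun y => h y + g y) ((hh y hy).add (hg y hy))]
    linarith [neg_le_of_abs_le (hle y hy)]
  have hanti : AntitoneOn (fun y => h y - g y) (Iic y₀) := by
    refine antitoneOn_of_deriv_nonpos (convex_Iic y₀)
      (fun y hy => ((hh y hy).sub (hg y hy)).continuousAt.continuousWithinAt)
      (fun y hy => ((hh y (le_of_mem_interior_Iic hy)).sub
        (hg y (le_of_mem_interior_Iic hy))).differentiableAt.differentiableWithinAt) fun y hy => ?_
    replace hy := le_of_mem_interior_Iic hy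
    rw [HasDerivAt.deriv (f := fun y => h y - g y) ((hh y hy).sub (hg y hy))]
    linarith [le_of_abs_le (hle y hy)]
  -- Clamping at `y₀` makes `h + g` monotone on the whole line; it is bounded below because `h + g ≥
  -- h - g ≥ h y₀ - g y₀`.
  have hm : Monotone fun y => h (min y y₀) + g (min y y₀) := fun x y hxy =>
    hmono (mem_Iic.2 (min_le_right _ _)) (mem_Iic.2 (min_le_right _ _)) (min_le_min_right _ hxy)
  have hbdd : BddBelow (range fun y => h (min y y₀) + g (min y y₀)) := by
    refine ⟨h y₀ - g y₀, ?_⟩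
    rintro _ ⟨y, rfl⟩
    have h1 := hanti (show min y y₀ ∈ Iic y₀ from mem_Iic.2 (min_le_right _ _)) self_mem_Iic (min_le_right _ _)
    have h2 := hg0 (min y y₀) (min_le_right _ _)
    simp only at h1 ⊢
    linarith
  have ht := (tendsto_atBot_ciInf hm hbdd).congr' (f₂ := fun y => h y + g y) (by
    filter_upwards [eventually_le_atBot y₀] with y hy
    rw [min_eq_left hy])
  exact ⟨_, (ht.sub hgt).congr fun y => add_sub_cancel_right _ _⟩

namespace IsCutoffWave

variable {f W p : ℝ → ℝ} {uc v : ℝ}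

theorem strictAnti (h : IsCutoffWave f uc v W) (hf : IsNormalisedKPP f)
    (huc : uc ∈ Ioo (0 : ℝ) 1) (hp : IsTrajectory f v 0 p) (hpu : p uc = v * uc) :
    StrictAnti W := by
  refine strictAnti_of_deriv_neg fun y => ?_
  obtain ⟨hm, hd⟩ := h.hasDerivAt_cutoffSlope hf huc hp hpu y
  rw [hd.deriv, neg_lt_zero]
  rcases le_total (W y) uc with hle | hle
  · rw [cutoffSlope_of_le hpu hle]
    exact mul_pos (h.right_eq huc.1).1 hm.1
  · rw [cutoffSlope_of_ge hle]
    exact hp.pos _ hm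

/-- Since `v W'` is continuous at `0`, the jump of `W''` is that of `-cutoff f uc (W y)`. -/
theorem deriv_deriv_jump (h : IsCutoffWave f uc v W) (hf : IsNormalisedKPP f)
    (huc : uc ∈ Ioo (0 : ℝ) 1) : ∃ a b c : ℝ,
      Tendsto (deriv (deriv W)) (𝓝[>] 0) (𝓝 a) ∧ Tendsto (deriv (deriv W)) (𝓝[<] 0) (𝓝 b) ∧
      Tendsto (cutoff f uc) (𝓝[>] uc) (𝓝 c) ∧ a - b = c := by
  have hv : Tendsto (fun y => -v * deriv W y) (𝓝 0) (𝓝 (-v * deriv W 0)) :=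
    (h.continuous_deriv.tendsto 0).const_mul (-v)
  have hfW : Tendsto (fun y => f (W y)) (𝓝 0) (𝓝 (f uc)) := by
    rw [← h.at_zero]
    exact (hf.continuous.comp h.continuous).tendsto 0
  refine ⟨-v * deriv W 0, -v * deriv W 0 - f uc, f uc, ?_, ?_, ?_, by ring⟩
  · refine (hv.mono_left nhdsWithin_le_nhds).congr' ?_
    filter_upwards [self_mem_nhdsWithin] with y hy
    have hy : 0 < y := hy
    rw [(h.hasDerivAt_deriv hy.ne').deriv, cutoff_of_le (h.right y hy).2, sub_zero]
  · refine ((hv.sub hfW).mono_left nhdsWithin_le_nhds).congr' ?_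
    filter_upwards [self_mem_nhdsWithin] with y hy
    have hy : y < 0 := hy
    rw [(h.hasDerivAt_deriv hy.ne).deriv, cutoff_of_lt (h.lt_left hf huc hy)]
  · refine ((hf.continuous.tendsto uc).mono_left nhdsWithin_le_nhds).congr' ?_
    filter_upwards [self_mem_nhdsWithin] with u hu using (cutoff_of_lt hu).symm

theorem hasDerivAt_log_one_sub (h : IsCutoffWave f uc v W) (hf : IsNormalisedKPP f)
    (huc : uc ∈ Ioo (0 : ℝ) 1) (hp : IsTrajectory f v 0 p) {y : ℝ} (hy : y < 0) :
    HasDerivAt (fun y => Real.log (1 - W y)) (p (W y) / (1 - W y)) y := by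
  have hm := h.mem_left hf huc hy
  refine (((h.hasDerivAt y).const_sub 1).log (by linarith [hm.2])).congr_deriv ?_
  rw [h.deriv_left hf huc hp hy, neg_neg]

theorem tendsto_nhdsLT_one (h : IsCutoffWave f uc v W) (hf : IsNormalisedKPP f)
    (huc : uc ∈ Ioo (0 : ℝ) 1) : Tendsto W atBot (𝓝[<] 1) := by
  refine tendsto_nhdsWithin_iff.2 ⟨h.tendsto_left, ?_⟩
  filter_upwards [eventually_lt_atBot 0] with y hy using (h.mem_left hf huc hy).2

theorem tendsto_log_div (h : IsCutoffWave f uc v W) (hf : IsNormalisedKPP f)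
    (huc : uc ∈ Ioo (0 : ℝ) 1) (hp : IsTrajectory f v 0 p) :
    Tendsto (fun y => Real.log (1 - W y) / y) atBot (𝓝 (lambdaPlus f v)) :=
  tendsto_div_of_tendsto_deriv_atBot (fun _ hy => h.hasDerivAt_log_one_sub hf huc hp hy)
    ((hp.tendsto_div_one_sub hf h.speed_nonneg).comp (h.tendsto_nhdsLT_one hf huc))

/-- The derivative of `log (1 - W) - λ₊ y` is `O((1 - W)^δ)`, which is dominated by the derivative
of a multiple of `(1 - W)^δ → 0`. The difference thus has a limit `l`, and `A = exp l`. -/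
theorem exists_isEquivalent (h : IsCutoffWave f uc v W) (hf : IsNormalisedKPP f)
    (huc : uc ∈ Ioo (0 : ℝ) 1) (hp : IsTrajectory f v 0 p) {δ : ℝ} (hδ : 0 < δ)
    (hO : (fun u => f u - deriv f 1 * (u - 1)) =O[𝓝[<] 1] (fun u => (1 - u) ^ (1 + δ))) :
    ∃ A : ℝ, 0 < A ∧
      (fun y => 1 - W y) ~[atBot] (fun y => A * Real.exp (lambdaPlus f v * y)) := by
  have hlam := lambdaPlus_pos hf.deriv_one v
  have hratio := (hp.tendsto_div_one_sub hf h.speed_nonneg).comp (h.tendsto_nhdsLT_one hf huc)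
  obtain ⟨C, u₀, hu₀, hC⟩ := hp.abs_div_one_sub_sub_le hf h.speed_nonneg hδ hO
  set lam := lambdaPlus f v
  obtain ⟨y₀, hy₀⟩ := eventually_atBot.1 (((hratio.eventually
    (lt_mem_nhds (half_lt_self hlam))).and (h.tendsto_left.eventually (lt_mem_nhds hu₀.2))).and
    (eventually_lt_atBot 0))
  -- Where `p(W)/(1 - W) > lam/2`, the derivative of `(1 - W)^δ` is at least `(δ lam/2)(1 - W)^δ`;
  -- `k` scales this up to `|C| (1 - W)^δ`.
  set k := |C| * (2 / (δ * lam)) with hk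
  have hpos : ∀ y ≤ y₀, 0 < 1 - W y := fun y hy => by
    linarith [(h.mem_left hf huc (hy₀ y hy).2).2]
  obtain ⟨l, hl⟩ := exists_tendsto_atBot_of_abs_deriv_le (y₀ := y₀)
    (h := fun y => Real.log (1 - W y) - lam * y) (h' := fun y => p (W y) / (1 - W y) - lam)
    (g := fun y => k * (1 - W y) ^ δ)
    (g' := fun y => k * (δ * (p (W y) / (1 - W y)) * (1 - W y) ^ δ))
    (fun y hy => by
      have hlin : HasDerivAt (fun y => lam * y) lam y := by
        simpa using (hasDerivAt_id y).const_mul lam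
      exact (h.hasDerivAt_log_one_sub hf huc hp (hy₀ y hy).2).sub hlin)
    (fun y hy => by
      have h1 := (((h.hasDerivAt y).const_sub 1).rpow_const (p := δ)
        (Or.inl (hpos y hy).ne')).const_mul k
      refine h1.congr_deriv ?_
      rw [h.deriv_left hf huc hp (hy₀ y hy).2, Real.rpow_sub_one (hpos y hy).ne']
      ring)
    (fun y hy => by
      obtain ⟨⟨h1, h2⟩, h3⟩ := hy₀ y hy
      have hT := Real.rpow_pos_of_pos (hpos y hy) δ
      have h1 : lam / 2 < p (W y) / (1 - W y) := h1
      calc |p (W y) / (1 - W y) - lam| ≤ C * (1 - W y) ^ δ :=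
            hC (W y) ⟨h2.le, (h.mem_left hf huc h3).2⟩
        _ ≤ |C| * (1 - W y) ^ δ := mul_le_mul_of_nonneg_right (le_abs_self C) hT.le
        _ = k * (δ * (lam / 2) * (1 - W y) ^ δ) := by rw [hk]; field_simp
        _ ≤ _ := by gcongr)
    (fun y hy => mul_nonneg (by positivity) (Real.rpow_nonneg (hpos y hy).le δ))
    (by
      have h1 : Tendsto (fun y => 1 - W y) atBot (𝓝 0) := by
        simpa using h.tendsto_left.const_sub 1
      have h2 := (h1.rpow_const (p := δ) (Or.inr hδ.le)).const_mul k
      rwa [Real.zero_rpow hδ.ne', mul_zero] at h2)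
  refine ⟨Real.exp l, Real.exp_pos l, isEquivalent_of_tendsto_one ?_⟩
  have h1 : Tendsto (fun y => Real.exp (Real.log (1 - W y) - lam * y - l)) atBot (𝓝 1) := by
    have := (Real.continuous_exp.tendsto (l - l)).comp (hl.sub_const l)
    rwa [sub_self, Real.exp_zero] at this
  refine h1.congr' ?_
  filter_upwards [eventually_le_atBot y₀] with y hy
  rw [Pi.div_apply, Real.exp_sub, Real.exp_sub, Real.exp_log (hpos y hy), div_div,
    mul_comm (Real.exp l)]

end IsCutoffWave

/-! ### The main theorem -/

theorem theorem1 (f : ℝ → ℝ) (hf : IsNormalisedKPP f) :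
    ∃ (vstar : ℝ → ℝ) (U : ℝ → ℝ → ℝ),
      (∀ uc ∈ Ioo (0 : ℝ) 1,
        -- existence of the travelling wave, and uniqueness of both its speed and its profile
        IsCutoffWave f uc (vstar uc) (U uc) ∧
        (∀ (v : ℝ) (W : ℝ → ℝ), IsCutoffWave f uc v W → v = vstar uc ∧ W = U uc) ∧
        0 < vstar uc ∧
        -- properties of the profile
        StrictAnti (U uc) ∧
        U uc 0 = uc ∧
        (∀ y : ℝ, 0 ≤ y → U uc y = uc * Real.exp (-(vstar uc) * y)) ∧
        (∃ a b c : ℝ,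
          Tendsto (deriv (deriv (U uc))) (𝓝[>] 0) (𝓝 a) ∧
          Tendsto (deriv (deriv (U uc))) (𝓝[<] 0) (𝓝 b) ∧
          Tendsto (cutoff f uc) (𝓝[>] uc) (𝓝 c) ∧
          a - b = c) ∧
        -- exponential approach to 1 with rate `λ₊`
        0 < lambdaPlus f (vstar uc) ∧
        Tendsto (fun y => Real.log (1 - U uc y) / y) atBot (𝓝 (lambdaPlus f (vstar uc))) ∧
        ((∃ δ : ℝ, 0 < δ ∧
            (fun u => f u - deriv f 1 * (u - 1)) =O[𝓝[<] 1] (fun u => (1 - u) ^ (1 + δ))) →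
          ∃ A : ℝ, 0 < A ∧
            (fun y => 1 - U uc y) ~[atBot]
              (fun y => A * Real.exp (lambdaPlus f (vstar uc) * y)))) ∧
      -- properties of the speed
      ContinuousOn vstar (Ioo 0 1) ∧
      StrictAntiOn vstar (Ioo 0 1) ∧
      Tendsto vstar (𝓝[>] 0) (𝓝 2) ∧
      IsLeast {v : ℝ | ∃ W : ℝ → ℝ, IsKPPWave f v W} 2 ∧
      Tendsto vstar (𝓝[<] 1) (𝓝 0) ∧
      vstar ~[𝓝[<] 1] (fun uc => |deriv f 1| ^ (1 / 2 : ℝ) * (1 - uc)) := by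
  obtain ⟨T, hT⟩ := hf.exists_isTrajectoryFamily
  obtain ⟨V, hV⟩ := hT.exists_isSpeedSelection hf
  have hex : ∀ uc, ∃ U, uc ∈ Ioo (0 : ℝ) 1 →
      IsCutoffWave f uc (V uc) U ∧ ∀ W, IsCutoffWave f uc (V uc) W → W = U := fun uc => by
    by_cases huc : uc ∈ Ioo (0 : ℝ) 1
    · obtain ⟨hv, hu⟩ := hV uc huc
      obtain ⟨U, hU, hU'⟩ := existsUnique_isCutoffWave hf huc hv (hT _ hv.le) hu
      exact ⟨U, fun _ => ⟨hU, hU'⟩⟩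
    · exact ⟨0, fun h => absurd h huc⟩
  choose U hU using hex
  refine ⟨V, U, fun uc huc => ?_, hT.continuousOn_speed hf hV, hT.strictAntiOn_speed hf hV,
    hT.tendsto_speed_zero hf hV, hf.isLeast_speed, hT.tendsto_speed_one hf hV,
    hT.speed_isEquivalent hf hV⟩
  obtain ⟨hwave, huniq⟩ := hU uc huc
  obtain ⟨hv, hu⟩ := hV uc huc
  have hp := hT _ hv.le
  refine ⟨hwave, fun v W hW => ?_, hv, hwave.strictAnti hf huc hp hu, hwave.at_zero,
    (hwave.right_eq huc.1).2.2, hwave.deriv_deriv_jump hf huc, lambdaPlus_pos hf.deriv_one _,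
    hwave.tendsto_log_div hf huc hp, fun ⟨δ, hδ, hO⟩ => hwave.exists_isEquivalent hf huc hp hδ hO⟩
  -- The two values of `W'(0)`, from the right and from the left, give `T v uc = v * uc`, which pins
  -- down the speed.
  have h1 := (hW.right_eq huc.1).2.1
  have h2 := hW.deriv_zero_eq hf huc (hT v hW.speed_nonneg)
  obtain rfl : v = V uc := hT.eq_of_isSpeedSelection hf hV huc hW.speed_nonneg (by linarith)
  exact ⟨rfl, huniq W hW⟩
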